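/- Positions are the points of $\mathbb{Z}^2$; two positions are adjacent if they are at distance $1$. A \emph{polyomino} is a finite non-empty set $P\subset\mathbb{Z}^2$ of positions (its tiles) whose induced grid graph is connected. It is \emph{non-degenerate} if any two tiles $t_1,t_2\in P$ whose unit squares share exactly one point have a common neighbor in $P$, i.e. there is a tile of $P$ adjacent to both. The \emph{2-scaled copy} $P^2$ is obtained by replacing each tile of $P$ by a $2\times 2$ square of tiles. \emph{Single step model.} For a shape $Q$ with $n$ tiles, the workspace is the set of $2n\times 2n$ positions $\{0,\dots,2n-1\}^2$, initially containing only a seed tile at $(n,n)$. While a set $A$ of positions is occupied, a tile located at a free position $p$ of the workspace may move to an adjacent position $q$ of the workspace provided that no position adjacent to $p$ is occupied. A \emph{construction step} is a finite sequence of such moves that takes a new tile from $(0,0)$ to a free position adjacent to an occupied position; this position then becomes occupied. The shape $Q$ is \emph{constructible} if some sequence of construction steps starting from the seed tile results in a translate of $Q$. \textbf{Theorem.} For every non-degenerate polyomino $P$, its $2$-scaled copy $P^2$ is constructible in the single step model. -/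

import Mathlib

namespace TiltAssembly

/-- The grid graph on the positions `ℤ × ℤ`: two positions are adjacent iff they are at unit
distance, i.e. iff the unit squares centred at them share an edge. -/
def gridGraph : SimpleGraph (ℤ × ℤ) where
  Adj p q := |p.1 - q.1| + |p.2 - q.2| = 1
  symm := ⟨fun p q h => by rw [abs_sub_comm q.1, abs_sub_comm q.2]; exact h⟩
  loopless := ⟨fun p h => by simp at h⟩

/-- A polyomino: a finite set of positions whose induced grid graph is connected
(in particular it has at least one tile). -/
def IsPolyomino (P : Finset (ℤ × ℤ)) : Prop :=
  (gridGraph.induce (P : Set (ℤ × ℤ))).Connected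

/-- The unit squares centred at `p` and `q` share exactly one point. -/
def ShareCorner (p q : ℤ × ℤ) : Prop :=
  |p.1 - q.1| = 1 ∧ |p.2 - q.2| = 1

/-- `P` is non-degenerate: any two tiles sharing exactly one point have a common neighbouring
tile of `P`. -/
def NonDegenerate (P : Finset (ℤ × ℤ)) : Prop :=
  ∀ t₁ ∈ P, ∀ t₂ ∈ P, ShareCorner t₁ t₂ → ∃ t ∈ P, gridGraph.Adj t t₁ ∧ gridGraph.Adj t t₂

/-- The `c`-scaled copy `P^c`: each tile is replaced by a `c × c` square of tiles. -/
noncomputable def scaledCopy (c : ℕ) (P : Finset (ℤ × ℤ)) : Finset (ℤ × ℤ) :=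
  P.biUnion fun p =>
    Finset.Ico (c * p.1) (c * p.1 + c) ×ˢ Finset.Ico (c * p.2) (c * p.2 + c)

/-- The translate of `P` by the vector `v`. -/
def translateBy (v : ℤ × ℤ) (P : Finset (ℤ × ℤ)) : Finset (ℤ × ℤ) :=
  P.map (addRightEmbedding v)

/-- The workspace: `2n × 2n` positions, anchored at `(0, 0)`. -/
noncomputable def workspace (n : ℕ) : Finset (ℤ × ℤ) :=
  Finset.Ico 0 (2 * n : ℤ) ×ˢ Finset.Ico 0 (2 * n : ℤ)

/-- With the positions of `A` occupied, a single tile at the position `p` of the workspace can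
move one unit step to the adjacent position `q` of the workspace: no position adjacent to `p` is
occupied (in particular `q` is free), since otherwise the tile sticks at `p`. -/
def Move (n : ℕ) (A : Finset (ℤ × ℤ)) (p q : ℤ × ℤ) : Prop :=
  p ∈ workspace n ∧ q ∈ workspace n ∧ gridGraph.Adj p q ∧
    p ∉ A ∧ ∀ r, gridGraph.Adj p r → r ∉ A

/-- A construction step onto `t`: a sequence of moves takes a tile from `(0, 0)` to the free
position `t`, which is adjacent to an occupied position. -/
def ConstructionStep (n : ℕ) (A : Finset (ℤ × ℤ)) (t : ℤ × ℤ) : Prop :=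
  Relation.ReflTransGen (Move n A) (0, 0) t ∧ t ∉ A ∧ ∃ r ∈ A, gridGraph.Adj t r

/-- The assembly `B` arises from the assembly `A` by one construction step. -/
def AddTile (n : ℕ) (A B : Finset (ℤ × ℤ)) : Prop :=
  ∃ t, ConstructionStep n A t ∧ B = insert t A

/-- `P`, with `n` tiles, is constructible in the single step model: in the `2n × 2n` workspace,
a sequence of construction steps builds a translate of `P` from the seed tile at `(n, n)`. -/
def Constructible (P : Finset (ℤ × ℤ)) : Prop :=
  ∃ v : ℤ × ℤ, Relation.ReflTransGen (AddTile P.card)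
    {((P.card : ℤ), (P.card : ℤ))} (translateBy v P)

end TiltAssembly

/-! ### Directions, corners and coordinates of tiles -/

namespace TiltAssembly

/-! The construction is found backwards: the scaled copy is taken apart tile by tile down to the
seed, and the order is reversed. Removing a tile is legitimate if it touches another tile and if a
free tile can hover beside it once it is gone (`Buildable.of_diff`). Hovering needs a position
without occupied neighbours, and a gap of one cell, two positions wide, has none while both its
sides are occupied. Once the tiles on one side are stripped, however, the lane beside that side is
clear, and the inner halves of the 2 × 2 cells still hold the shape together.

A walk therefore follows the outer boundary from the leftmost cell of the top row, with the outside
on its left, and strips the sides it passes (`State.sweep`). A tile whose diagonal cell belongs to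
the shape is kept: the position in front of it is blocked by that diagonal cell anyway.
Non-degeneracy lets the walk round convex corners and rules out cells touching in a bare point.

After a right turn the last cell has at most two tiles left. It is removed if it is a leaf, if the
fourth cell of the 2 × 2 block at the turn keeps its neighbours joined, or together with the
preceding cell if a detour exists. The walk then steps back and continues in the smaller shape
(`State.pop_one`, `State.pop_two`, `State.pop_leaf`).

The walk never returns to a former cell without meeting a removable one (`Walk.no_loop`). Points on
the left of the walk are connected to the outside, so a loop has winding number zero around them.
Hence it runs to the right in its top row and to the left in its bottom row. It cannot lie in a
single row, so one of these rows avoids its first cell, and the right turn where the loop finally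
leaves that row gives a removable cell. Induction on the number of cells and on the boundary left to
walk (`State.buildable`) ends with a single tile, the seed. -/

/-- Clockwise rotation by a quarter turn. -/
def cw (d : ℤ × ℤ) : ℤ × ℤ := (d.2, -d.1)

/-- Unit vectors. -/
def IsDir (d : ℤ × ℤ) : Prop :=
  d = (1, 0) ∨ d = (-1, 0) ∨ d = (0, 1) ∨ d = (0, -1)

/-- Perpendicular unit vectors. -/
def Perp (p q : ℤ × ℤ) : Prop := IsDir p ∧ (q = cw p ∨ q = -cw p)

/-- The four corners of a cell. -/
def IsCorner (u : ℤ × ℤ) : Prop := (u.1 = 1 ∨ u.1 = -1) ∧ (u.2 = 1 ∨ u.2 = -1)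

lemma cw_cw (d : ℤ × ℤ) : cw (cw d) = -d := by ext <;> simp [cw]
lemma cw_neg (d : ℤ × ℤ) : cw (-d) = -cw d := by ext <;> simp [cw]

lemma IsDir.neg {d : ℤ × ℤ} (h : IsDir d) : IsDir (-d) := by
  rcases h with rfl | rfl | rfl | rfl <;> simp [IsDir]

lemma IsDir.rot {d : ℤ × ℤ} (h : IsDir d) : IsDir (cw d) := by
  rcases h with rfl | rfl | rfl | rfl <;> simp [IsDir, cw]

lemma IsDir.perp {d : ℤ × ℤ} (h : IsDir d) : Perp d (cw d) := ⟨h, Or.inl rfl⟩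

lemma Perp.symm {p q : ℤ × ℤ} (h : Perp p q) : Perp q p := by
  obtain ⟨h, rfl | rfl⟩ := h
  · exact ⟨h.rot, Or.inr (by rw [cw_cw, neg_neg])⟩
  · exact ⟨h.rot.neg, Or.inl (by rw [cw_neg, cw_cw, neg_neg])⟩

lemma Perp.neg_left {p q : ℤ × ℤ} (h : Perp p q) : Perp (-p) q := by
  obtain ⟨h, rfl | rfl⟩ := h
  · exact ⟨h.neg, Or.inr (by rw [cw_neg, neg_neg])⟩
  · exact ⟨h.neg, Or.inl (by rw [cw_neg])⟩

lemma Perp.neg_right {p q : ℤ × ℤ} (h : Perp p q) : Perp p (-q) := h.symm.neg_left.symm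

lemma Perp.cases {p q : ℤ × ℤ} (h : Perp p q) :
    (p = (1, 0) ∧ q = (0, 1)) ∨ (p = (1, 0) ∧ q = (0, -1)) ∨
    (p = (-1, 0) ∧ q = (0, 1)) ∨ (p = (-1, 0) ∧ q = (0, -1)) ∨
    (p = (0, 1) ∧ q = (1, 0)) ∨ (p = (0, 1) ∧ q = (-1, 0)) ∨
    (p = (0, -1) ∧ q = (1, 0)) ∨ (p = (0, -1) ∧ q = (-1, 0)) := by
  obtain ⟨rfl | rfl | rfl | rfl, rfl | rfl⟩ := h <;> simp [cw]

lemma Perp.isCorner {p q : ℤ × ℤ} (h : Perp p q) : IsCorner (p + q) := by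
  rcases h.cases with ⟨rfl, rfl⟩ | ⟨rfl, rfl⟩ | ⟨rfl, rfl⟩ | ⟨rfl, rfl⟩ | ⟨rfl, rfl⟩ | ⟨rfl, rfl⟩ |
    ⟨rfl, rfl⟩ | ⟨rfl, rfl⟩ <;> simp [IsCorner]

lemma IsCorner.exists_perp {u : ℤ × ℤ} (h : IsCorner u) : ∃ p q, Perp p q ∧ u = p + q := by
  obtain ⟨a, b⟩ := u
  obtain ⟨rfl | rfl, rfl | rfl⟩ := h
  · exact ⟨(1, 0), (0, 1), by simp [Perp, IsDir, cw], by simp⟩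
  · exact ⟨(1, 0), (0, -1), by simp [Perp, IsDir, cw], by simp⟩
  · exact ⟨(-1, 0), (0, 1), by simp [Perp, IsDir, cw], by simp⟩
  · exact ⟨(-1, 0), (0, -1), by simp [Perp, IsDir, cw], by simp⟩

lemma gridGraph_adj_iff {p q : ℤ × ℤ} : gridGraph.Adj p q ↔ IsDir (q - p) := by
  obtain ⟨a, b⟩ := p
  obtain ⟨c, d⟩ := q
  simp only [gridGraph, IsDir, Prod.mk_sub_mk, Prod.mk.injEq]
  grind

lemma gridGraph_adj_add {p d : ℤ × ℤ} (h : IsDir d) : gridGraph.Adj p (p + d) := by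
  rw [gridGraph_adj_iff]; simpa using h

lemma shareCorner_iff {p q : ℤ × ℤ} : ShareCorner p q ↔ IsCorner (q - p) := by
  simp only [ShareCorner, IsCorner, Prod.fst_sub, Prod.snd_sub]
  grind

/-- The position of the tile at corner `t.2` of the cell `t.1` in the copy translated by `v`. -/
def pt (v : ℤ × ℤ) (t : (ℤ × ℤ) × (ℤ × ℤ)) : ℤ × ℤ :=
  (2 * t.1.1 + (t.2.1 + 1) / 2 + v.1, 2 * t.1.2 + (t.2.2 + 1) / 2 + v.2)

/-- For a corner, `(u + 1) / 2` is 0 or 1 in each coordinate, so cell and corner are quotient and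
remainder modulo 2. -/
lemma pt_inj {v : ℤ × ℤ} {s t : (ℤ × ℤ) × (ℤ × ℤ)} (hs : IsCorner s.2) (ht : IsCorner t.2)
    (h : pt v s = pt v t) : s = t := by
  obtain ⟨⟨a, b⟩, c, d⟩ := s
  obtain ⟨⟨a', b'⟩, c', d'⟩ := t
  simp only [pt, IsCorner, Prod.mk.injEq] at *
  omega

lemma adj_flip {p q : ℤ × ℤ} (h : Perp p q) (v c : ℤ × ℤ) :
    gridGraph.Adj (pt v (c, p + q)) (pt v (c, -p + q)) := by
  rcases h.cases with ⟨rfl, rfl⟩ | ⟨rfl, rfl⟩ | ⟨rfl, rfl⟩ | ⟨rfl, rfl⟩ | ⟨rfl, rfl⟩ | ⟨rfl, rfl⟩ |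
    ⟨rfl, rfl⟩ | ⟨rfl, rfl⟩ <;> simp [gridGraph, pt]

lemma adj_out {p q : ℤ × ℤ} (h : Perp p q) (v c : ℤ × ℤ) :
    gridGraph.Adj (pt v (c, p + q)) (pt v (c + p, -p + q)) := by
  rw [gridGraph_adj_iff]
  rcases h.cases with ⟨rfl, rfl⟩ | ⟨rfl, rfl⟩ | ⟨rfl, rfl⟩ | ⟨rfl, rfl⟩ | ⟨rfl, rfl⟩ | ⟨rfl, rfl⟩ |
    ⟨rfl, rfl⟩ | ⟨rfl, rfl⟩ <;> simp [pt, IsDir] <;> omega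

lemma adj_flip' {p q : ℤ × ℤ} (h : Perp p q) (v c : ℤ × ℤ) :
    gridGraph.Adj (pt v (c, p + q)) (pt v (c, p + -q)) := by
  have := adj_flip h.symm v c
  rwa [add_comm q, add_comm (-q)] at this

lemma adj_out' {p q : ℤ × ℤ} (h : Perp p q) (v c : ℤ × ℤ) :
    gridGraph.Adj (pt v (c, p + q)) (pt v (c + q, p + -q)) := by
  have := adj_out h.symm v c
  rwa [add_comm q, add_comm (-q)] at this

/-- A tile has two neighbours in its own cell and one in each cell across the sides `p` and `q`.
Hovering is thus a condition on five tiles, the hypotheses `h0` to `h4` of `Hover.step`. -/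
lemma eq_of_adj_pt {p q v c z : ℤ × ℤ} (h : Perp p q) (hz : gridGraph.Adj (pt v (c, p + q)) z) :
    z = pt v (c, -p + q) ∨ z = pt v (c, p + -q) ∨ z = pt v (c + p, -p + q) ∨
      z = pt v (c + q, p + -q) := by
  rw [gridGraph_adj_iff] at hz
  obtain ⟨z1, z2⟩ := z
  obtain ⟨c1, c2⟩ := c
  simp only [IsDir, pt, Prod.mk_sub_mk, Prod.mk.injEq] at hz ⊢
  rcases h.cases with ⟨rfl, rfl⟩ | ⟨rfl, rfl⟩ | ⟨rfl, rfl⟩ | ⟨rfl, rfl⟩ | ⟨rfl, rfl⟩ | ⟨rfl, rfl⟩ |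
    ⟨rfl, rfl⟩ | ⟨rfl, rfl⟩ <;> simp at hz ⊢ <;> omega

/-! ### Hovering tiles and reversed construction steps -/

/-- No tile of `S` is at `z` or next to `z`. -/
def ClearAt (v : ℤ × ℤ) (S : Set ((ℤ × ℤ) × (ℤ × ℤ))) (z : ℤ × ℤ) : Prop :=
  z ∉ pt v '' S ∧ ∀ w, gridGraph.Adj z w → w ∉ pt v '' S

/-- A new tile can hover at `t` while `S` is occupied. -/
def Hover (n : ℕ) (v : ℤ × ℤ) (S : Set ((ℤ × ℤ) × (ℤ × ℤ))) (t : (ℤ × ℤ) × (ℤ × ℤ)) : Prop :=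
  Relation.ReflTransGen (fun a b => a ∈ workspace n ∧ b ∈ workspace n ∧ gridGraph.Adj a b ∧
    ClearAt v S a) (0, 0) (pt v t) ∧ pt v t ∈ workspace n ∧ ClearAt v S (pt v t)

/-- The tile set `S` can be built from the seed. -/
def Buildable (n : ℕ) (v : ℤ × ℤ) (S : Set ((ℤ × ℤ) × (ℤ × ℤ))) : Prop :=
  ∃ F : Finset (ℤ × ℤ), (F : Set (ℤ × ℤ)) = pt v '' S ∧
    Relation.ReflTransGen (AddTile n) {((n : ℤ), (n : ℤ))} F

lemma ClearAt.mono {v z : ℤ × ℤ} {S T : Set ((ℤ × ℤ) × (ℤ × ℤ))} (hTS : T ⊆ S)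
    (h : ClearAt v S z) : ClearAt v T z :=
  ⟨fun hz => h.1 (Set.image_mono hTS hz), fun w hw hz => h.2 w hw (Set.image_mono hTS hz)⟩

/-- Access once gained is kept, since disassembly only removes tiles. -/
lemma Hover.mono {n : ℕ} {v : ℤ × ℤ} {S T : Set ((ℤ × ℤ) × (ℤ × ℤ))}
    {t : (ℤ × ℤ) × (ℤ × ℤ)} (hTS : T ⊆ S) (h : Hover n v S t) : Hover n v T t :=
  ⟨Relation.ReflTransGen.mono (fun _ _ hab => ⟨hab.1, hab.2.1, hab.2.2.1, hab.2.2.2.mono hTS⟩) _ _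
    h.1, h.2.1,
    h.2.2.mono hTS⟩

lemma Hover.step {n : ℕ} {v c p q : ℤ × ℤ} {S : Set ((ℤ × ℤ) × (ℤ × ℤ))}
    {s : (ℤ × ℤ) × (ℤ × ℤ)} (hS : ∀ t ∈ S, IsCorner t.2) (hpq : Perp p q) (hs : Hover n v S s)
    (hadj : gridGraph.Adj (pt v s) (pt v (c, p + q)))
    (hw : pt v (c, p + q) ∈ workspace n)
    (h0 : (c, p + q) ∉ S) (h1 : (c, -p + q) ∉ S) (h2 : (c, p + -q) ∉ S)
    (h3 : (c + p, -p + q) ∉ S) (h4 : (c + q, p + -q) ∉ S) : Hover n v S (c, p + q) := by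
  have key : ∀ c' u, IsCorner u → (c', u) ∉ S → pt v (c', u) ∉ pt v '' S := by
    rintro c' u hu hn ⟨t, ht, he⟩
    rw [pt_inj (hS t ht) hu he] at ht
    exact hn ht
  refine ⟨hs.1.tail ⟨hs.2.1, hw, hadj, hs.2.2⟩, hw, key _ _ hpq.isCorner h0, fun w hadj => ?_⟩
  rcases eq_of_adj_pt hpq hadj with rfl | rfl | rfl | rfl
  · exact key _ _ hpq.neg_left.isCorner h1
  · exact key _ _ hpq.neg_right.isCorner h2
  · exact key _ _ hpq.neg_left.isCorner h3
  · exact key _ _ hpq.neg_right.isCorner h4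

/-- A tile set is buildable if one of its tiles can be put last. -/
lemma Buildable.of_diff {n : ℕ} {v : ℤ × ℤ} {S : Set ((ℤ × ℤ) × (ℤ × ℤ))}
    {s t r : (ℤ × ℤ) × (ℤ × ℤ)} (hS : ∀ t ∈ S, IsCorner t.2) (h : Buildable n v (S \ {t}))
    (hw : pt v t ∈ workspace n) (hs : Hover n v (S \ {t}) s)
    (hst : gridGraph.Adj (pt v s) (pt v t))
    (hr : r ∈ S) (hrt : r ≠ t) (htr : gridGraph.Adj (pt v t) (pt v r)) : Buildable n v S := by
  -- An absent tile costs nothing, so callers need not know whether `t` has been stripped before.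
  by_cases ht : t ∈ S
  swap
  · rwa [Set.sdiff_singleton_eq_self ht] at h
  obtain ⟨F, hF, hF'⟩ := h
  have hmem : ∀ z, z ∈ F ↔ z ∈ pt v '' (S \ {t}) := fun z => by rw [← hF]; simp
  refine ⟨insert (pt v t) F, ?_, hF'.tail ⟨pt v t, ⟨?_, ?_, pt v r, ?_, htr⟩, rfl⟩⟩
  · rw [Finset.coe_insert, hF, ← Set.image_insert_eq, Set.insert_sdiff_singleton,
      Set.insert_eq_of_mem ht]
  · have h1 : ∀ a b, (a ∈ workspace n ∧ b ∈ workspace n ∧ gridGraph.Adj a b ∧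
        ClearAt v (S \ {t}) a) → Move n F a b := fun a b hab =>
      ⟨hab.1, hab.2.1, hab.2.2.1, by rw [hmem]; exact hab.2.2.2.1,
        fun w hw => by rw [hmem]; exact hab.2.2.2.2 w hw⟩
    exact (Relation.ReflTransGen.mono h1 _ _ hs.1).tail (h1 _ _ ⟨hs.2.1, hw, hst, hs.2.2⟩)
  · rw [hmem]
    rintro ⟨t', ht', he⟩
    exact ht'.2 (pt_inj (hS _ ht'.1) (hS _ ht) he)
  · rw [hmem]
    exact ⟨r, ⟨hr, hrt⟩, rfl⟩

/-! ### Stripped tile sets, rooted shapes and boundary walks -/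

@[simp] lemma cw_iterate_two (d : ℤ × ℤ) : cw^[2] d = -d := cw_cw d
@[simp] lemma cw_iterate_three (d : ℤ × ℤ) : cw^[3] d = -cw d := by
  rw [Function.iterate_succ_apply', cw_iterate_two, cw_neg]

lemma IsDir.iterate {d : ℤ × ℤ} (h : IsDir d) (s : ℕ) : IsDir (cw^[s] d) := by
  induction s with
  | zero => exact h
  | succ s ih => rw [Function.iterate_succ_apply']; exact ih.rot

lemma IsDir.ne_cw {d : ℤ × ℤ} (h : IsDir d) : d ≠ cw d := by
  rcases h with rfl | rfl | rfl | rfl <;> simp [cw]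

lemma IsDir.ne_neg {d : ℤ × ℤ} (h : IsDir d) : d ≠ -d := by
  rcases h with rfl | rfl | rfl | rfl <;> simp

lemma IsDir.ne_neg_cw {d : ℤ × ℤ} (h : IsDir d) : d ≠ -cw d := by
  rcases h with rfl | rfl | rfl | rfl <;> simp [cw]

lemma IsDir.ne_zero {d : ℤ × ℤ} (h : IsDir d) : d ≠ 0 := by
  rcases h with rfl | rfl | rfl | rfl <;> simp

lemma Perp.add_inj {p q p' q' : ℤ × ℤ} (h : Perp p q) (h' : Perp p' q') (he : p + q = p' + q') :
    (p = p' ∧ q = q') ∨ (p = q' ∧ q = p') := by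
  rcases h.cases with ⟨rfl, rfl⟩ | ⟨rfl, rfl⟩ | ⟨rfl, rfl⟩ | ⟨rfl, rfl⟩ | ⟨rfl, rfl⟩ | ⟨rfl, rfl⟩ |
    ⟨rfl, rfl⟩ | ⟨rfl, rfl⟩ <;>
  rcases h'.cases with ⟨rfl, rfl⟩ | ⟨rfl, rfl⟩ | ⟨rfl, rfl⟩ | ⟨rfl, rfl⟩ | ⟨rfl, rfl⟩ |
    ⟨rfl, rfl⟩ | ⟨rfl, rfl⟩ | ⟨rfl, rfl⟩ <;> simp at he ⊢

/-- The tiles of the cells of `Q`, except those whose diagonal cell is free and which lie on a side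
in `σ`. -/
def tiles (Q : Finset (ℤ × ℤ)) (σ : ℤ × ℤ → ℤ × ℤ → Prop) : Set ((ℤ × ℤ) × (ℤ × ℤ)) :=
  {t | t.1 ∈ Q ∧ IsCorner t.2 ∧
    (t.1 + t.2 ∈ Q ∨ ∀ p q, Perp p q → t.2 = p + q → ¬ σ t.1 p)}

lemma mem_tiles {Q : Finset (ℤ × ℤ)} {σ : ℤ × ℤ → ℤ × ℤ → Prop} {c p q : ℤ × ℤ} (h : Perp p q) :
    (c, p + q) ∈ tiles Q σ ↔ c ∈ Q ∧ (c + p + q ∈ Q ∨ (¬ σ c p ∧ ¬ σ c q)) := by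
  simp only [tiles, Set.mem_ofPred_eq, h.isCorner, true_and, ← add_assoc]
  refine and_congr_right fun _ => or_congr_right ⟨fun H => ⟨H p q h rfl, H q p h.symm
    (add_comm _ _)⟩, fun H p' q' h' he => ?_⟩
  rcases h.add_inj h' he with ⟨rfl, -⟩ | ⟨-, rfl⟩
  exacts [H.1, H.2]

lemma isCorner_of_mem_tiles {Q : Finset (ℤ × ℤ)} {σ : ℤ × ℤ → ℤ × ℤ → Prop} :
    ∀ t ∈ tiles Q σ, IsCorner t.2 := fun _ h => h.2.1

/-- Tile sets are equal if they have the same tiles in the form of `mem_tiles`. -/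
lemma tiles_ext {S T : Set ((ℤ × ℤ) × (ℤ × ℤ))} (hS : ∀ t ∈ S, IsCorner t.2)
    (hT : ∀ t ∈ T, IsCorner t.2)
    (h : ∀ c p q, Perp p q → ((c, p + q) ∈ S ↔ (c, p + q) ∈ T)) : S = T := by
  ext ⟨c, u⟩
  constructor <;> intro hm
  · obtain ⟨p, q, hpq, rfl⟩ := IsCorner.exists_perp (hS _ hm)
    exact (h c p q hpq).1 hm
  · obtain ⟨p, q, hpq, rfl⟩ := IsCorner.exists_perp (hT _ hm)
    exact (h c p q hpq).2 hm

/-- A connected non-degenerate set of cells, rooted at the leftmost cell of its top row. -/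
structure Shape (r : ℤ × ℤ) (Q : Finset (ℤ × ℤ)) : Prop where
  root : r ∈ Q
  conn : ∀ c ∈ Q, Relation.ReflTransGen (fun a b => b ∈ Q ∧ gridGraph.Adj a b) r c
  nondeg : NonDegenerate Q
  top : ∀ c ∈ Q, c.2 ≤ r.2
  left : r + (-1, 0) ∉ Q

/-- The only common neighbours of two diagonal cells are the other two cells of their 2 × 2 block.
Non-degeneracy enters the boundary geometry in this form. -/
lemma Shape.diag {r c p q : ℤ × ℤ} {Q : Finset (ℤ × ℤ)} (h : Shape r Q) (hpq : Perp p q)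
    (hc : c ∈ Q) (hp : c + p ∉ Q) (hd : c + p + q ∈ Q) : c + q ∈ Q := by
  obtain ⟨t, ht, h1, h2⟩ := h.nondeg c hc _ hd (by
    rw [shareCorner_iff]; simpa [add_assoc] using hpq.isCorner)
  rw [gridGraph_adj_iff] at h1 h2
  obtain ⟨t1, t2⟩ := t
  obtain ⟨c1, c2⟩ := c
  have : (t1, t2) = (c1, c2) + p ∨ (t1, t2) = (c1, c2) + q := by
    simp only [IsDir, Prod.mk_sub_mk] at h1 h2
    rcases hpq.cases with ⟨rfl, rfl⟩ | ⟨rfl, rfl⟩ | ⟨rfl, rfl⟩ | ⟨rfl, rfl⟩ | ⟨rfl, rfl⟩ |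
      ⟨rfl, rfl⟩ | ⟨rfl, rfl⟩ | ⟨rfl, rfl⟩ <;> simp at h1 h2 ⊢ <;> omega
  rcases this with h | h
  · exact absurd (h ▸ ht) hp
  · exact h ▸ ht

/-- A walk along the outer boundary of `Q` with the outside on its left: at the `j`-th cell `b j`,
entered from the direction `x j`, the next `i j` directions in clockwise order are free, and
(for `j < k`) the walk leaves in the direction after them. -/
structure Walk (r : ℤ × ℤ) (Q : Finset (ℤ × ℤ)) (k : ℕ) (b x : ℕ → ℤ × ℤ) (i : ℕ → ℕ) :
    Prop where
  b_zero : b 0 = r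
  x_zero : x 0 = (-1, 0)
  inj : ∀ j ≤ k, ∀ j' ≤ k, b j = b j' → j = j'
  mem : ∀ j ≤ k, b j ∈ Q
  le_two : ∀ j ≤ k, i j ≤ 2
  free : ∀ j ≤ k, ∀ s, 1 ≤ s → s ≤ i j → b j + cw^[s] (x j) ∉ Q
  b_succ : ∀ j < k, b (j + 1) = b j + cw^[i j + 1] (x j)
  x_succ : ∀ j < k, x (j + 1) = -cw^[i j + 1] (x j)

/-- The side of the cell `c` in the direction `n` is passed by the walk. -/
def Passed (k : ℕ) (b x : ℕ → ℤ × ℤ) (i : ℕ → ℕ) (c n : ℤ × ℤ) : Prop :=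
  ∃ j ≤ k, c = b j ∧ ∃ s, 1 ≤ s ∧ s ≤ i j ∧ n = cw^[s] (x j)

namespace Walk

variable {r : ℤ × ℤ} {Q : Finset (ℤ × ℤ)} {k : ℕ} {b x : ℕ → ℤ × ℤ} {i : ℕ → ℕ}

lemma isDir (h : Walk r Q k b x i) : ∀ j ≤ k, IsDir (x j) := by
  intro j
  induction j with
  | zero => intro _; rw [h.x_zero]; simp [IsDir]
  | succ j ih => intro hj; rw [h.x_succ j hj]; exact ((ih (by omega)).iterate _).neg

lemma b_add_x (h : Walk r Q k b x i) {j : ℕ} (hj : j < k) : b (j + 1) + x (j + 1) = b j := by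
  rw [h.b_succ j hj, h.x_succ j hj]; abel

lemma b_add_x_mem (h : Walk r Q k b x i) {j : ℕ} (hj : j ≤ k) (h0 : j ≠ 0) : b j + x j ∈ Q := by
  obtain ⟨j, rfl⟩ := Nat.exists_eq_succ_of_ne_zero h0
  rw [Nat.succ_eq_add_one, h.b_add_x hj]
  exact h.mem _ (by omega)

/-- Nothing lies above the root, so the walk cannot turn left there. -/
lemma one_le_i_zero (h : Walk r Q k b x i) (hs : Shape r Q) (hk : 1 ≤ k) : 1 ≤ i 0 := by
  by_contra h0
  have h1 := h.b_succ 0 (by omega)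
  have h2 := hs.top _ (h.mem 1 hk)
  rw [show i 0 = 0 by omega, h.b_zero, h.x_zero] at h1
  simp only [zero_add, Function.iterate_one, cw] at h1
  rw [h1] at h2
  simp at h2

/-- If the free cell to the left of `b j` is bordered by a cell behind it, then the walk comes from
that cell by a left turn. -/
lemma concave (h : Walk r Q k b x i) (hs : Shape r Q) {j : ℕ} (hj : j ≤ k)
    (hc : b j + cw (x j) ∉ Q) (hd : b j + cw (x j) + x j ∈ Q) :
    ∃ j', j = j' + 2 ∧ i (j' + 1) = 0 ∧ b j' = b j + cw (x j) + x j ∧ 1 ≤ i j' ∧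
      cw^[i j'] (x j') = -x j := by
  rcases j with _ | j
  · have := hs.top _ hd
    rw [h.b_zero, h.x_zero] at this
    simp [cw] at this
  have hb := h.b_succ j hj
  have hx := h.x_succ j hj
  have hi := h.le_two j (by omega)
  have hfree := h.free j (by omega) (i j)
  -- After a straight step or a right turn, the left rear cell is across a side just passed, hence
  -- free. So the walk turned left.
  have i0 : i j = 0 := by
    by_contra h0
    have : i j = 1 ∨ i j = 2 := by omega
    apply hfree (by omega) le_rfl
    rcases this with h1 | h1 <;> rw [h1] at hb hx ⊢ <;> rw [hb, hx] at hd <;>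
      simp only [Function.iterate_one, cw_iterate_two, cw_iterate_three, Nat.reduceAdd,
        cw_cw, neg_neg] at hd ⊢ <;>
      convert hd using 1 <;> abel
  rw [i0] at hb hx
  simp only [zero_add, Function.iterate_one] at hb hx
  rw [hb, hx] at hd hc
  simp only [cw_neg, cw_cw, neg_neg] at hd hc
  rcases j with _ | j
  · exfalso
    have := h.one_le_i_zero hs (by omega)
    omega
  have hxj := h.x_succ j (by omega)
  have hbj := h.b_add_x (j := j) (by omega)
  have e : b (j + 1) + cw (x (j + 1)) + x (j + 1) = b j + cw (x (j + 1)) := by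
    rw [← hbj]; abel
  rw [e] at hc
  refine ⟨j, rfl, i0, ?_, ?_, ?_⟩
  · rw [hb, hx, ← hbj]; simp only [cw_neg, cw_cw]; abel
  -- Two left turns in a row would make the cell on the left the one visited before `b j`, which
  -- lies in `Q`.
  · by_contra h0
    rw [hxj, show i j = 0 by omega] at hc
    simp only [zero_add, Function.iterate_one, cw_neg, cw_cw, neg_neg] at hc
    rcases j with _ | j
    · have := h.one_le_i_zero hs (by omega)
      omega
    · exact hc (h.b_add_x_mem (by omega) (by omega))
  · rw [hx, hxj, Function.iterate_succ_apply']; simp [cw_neg, cw_cw]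

lemma passed_iff (h : Walk r Q k b x i) {j : ℕ} (hj : j ≤ k) {n : ℤ × ℤ} :
    Passed k b x i (b j) n ↔ ∃ s, 1 ≤ s ∧ s ≤ i j ∧ n = cw^[s] (x j) := by
  constructor
  · rintro ⟨j', hj', he, H⟩
    rwa [h.inj j hj j' hj' he]
  · exact fun H => ⟨j, hj, rfl, H⟩

/-- The inner tile at the exit of a cell is not on a passed side. -/
lemma not_passed_exit (h : Walk r Q k b x i) {j : ℕ} (hj : j ≤ k) :
    ¬ Passed k b x i (b j) (cw^[i j + 1] (x j)) ∧
    ¬ Passed k b x i (b j) (cw^[i j + 2] (x j)) := by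
  rw [h.passed_iff hj, h.passed_iff hj]
  have hi := h.le_two j hj
  have hd := h.isDir j hj
  generalize i j = m at *
  generalize x j = y at *
  constructor <;> rintro ⟨s, h1, h2, h3⟩ <;> interval_cases m <;> interval_cases s <;>
    rcases hd with rfl | rfl | rfl | rfl <;> simp [cw] at h3

/-- A passed side whose end touches the last cell of the walk diagonally. -/
lemma release (h : Walk r Q k b x i) (hs : Shape r Q) {j s : ℕ} {q : ℤ × ℤ} (hj : j < k)
    (hs1 : 1 ≤ s) (hsi : s ≤ i j) (hq : Perp (cw^[s] (x j)) q)
    (hd : b j + cw^[s] (x j) + q = b k) : j + 2 = k ∧ i (j + 1) = 0 ∧ s = i j := by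
  have hi := h.le_two j hj.le
  have hfree := h.free j hj.le s hs1 hsi
  have hk := h.mem k le_rfl
  rcases hq.2 with hq' | hq'
  -- Here `q` is the next direction clockwise. It is occupied by non-degeneracy, so the side `s` is
  -- the last one passed and `q` is the exit.
  · have hbq : b j + q ∈ Q := hs.diag hq (h.mem j hj.le) hfree (hd ▸ hk)
    rw [← Function.iterate_succ_apply' cw] at hq'
    have hsi' : s = i j := by
      by_contra hne
      exact h.free j hj.le (s + 1) (by omega) (by omega) (hq' ▸ hbq)
    subst hsi'
    have hb := h.b_succ j hj
    have hx := h.x_succ j hj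
    rw [← hq'] at hb hx
    have e : cw (x (j + 1)) = cw^[i j] (x j) := by
      rw [hx, hq', Function.iterate_succ_apply', cw_neg, cw_cw, neg_neg]
    have hb2 : b (j + 1) + cw (x (j + 1)) = b k := by rw [hb, e, ← hd]; abel
    have hne : j + 1 ≠ k := by
      rintro rfl
      exact (h.isDir _ le_rfl).rot.ne_zero (by simpa using hb2)
    have h0 : i (j + 1) = 0 := by
      by_contra h0
      refine h.free (j + 1) (by omega) 1 le_rfl (by omega) ?_
      rw [Function.iterate_one, hb2]; exact hk
    have hb3 := h.b_succ (j + 1) (by omega)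
    rw [h0, zero_add, Function.iterate_one, hb2] at hb3
    exact ⟨h.inj _ (by omega) _ le_rfl hb3, h0, rfl⟩
  -- Here `q` is counterclockwise. For `s = 1` the corner is concave and `b k` would have been
  -- visited two steps before `b j`; for `s = 2` non-degeneracy would occupy the first passed side.
  · exfalso
    have hs12 : s = 1 ∨ s = 2 := by omega
    rcases hs12 with rfl | rfl
    · simp only [Function.iterate_one, cw_cw, neg_neg] at hq' hd hfree
      rw [hq'] at hd
      obtain ⟨j', h1, -, h2, -⟩ := h.concave hs hj.le hfree (by rw [hd]; exact hk)
      rw [hd] at h2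
      have := h.inj _ (by omega) _ le_rfl h2
      omega
    · simp only [cw_iterate_two, cw_neg, neg_neg] at hq' hd hfree hq
      have h1 := h.free j hj.le 1 le_rfl (by omega)
      rw [Function.iterate_one] at h1
      rw [hq'] at hd hq
      exact h1 (hs.diag hq (h.mem j hj.le) hfree (hd ▸ hk))

end Walk

/-! ### Stripping the tiles along a free side -/

/-- The cells of `Q` and the cells around them lie in the workspace. -/
def Room (n : ℕ) (v : ℤ × ℤ) (Q : Finset (ℤ × ℤ)) : Prop :=
  ∀ c ∈ Q, ∀ d : ℤ × ℤ, |d.1| ≤ 1 → |d.2| ≤ 1 → ∀ u, IsCorner u → pt v (c + d, u) ∈ workspace n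

section

variable {n : ℕ} {v : ℤ × ℤ} {Q : Finset (ℤ × ℤ)}

lemma Room.self (h : Room n v Q) {c u : ℤ × ℤ} (hc : c ∈ Q) (hu : IsCorner u) :
    pt v (c, u) ∈ workspace n := by
  simpa using h c hc 0 (by simp) (by simp) u hu

lemma Room.dir (h : Room n v Q) {c d u : ℤ × ℤ} (hc : c ∈ Q) (hd : IsDir d) (hu : IsCorner u) :
    pt v (c + d, u) ∈ workspace n := by
  refine h c hc d ?_ ?_ u hu <;> rcases hd with rfl | rfl | rfl | rfl <;> simp

lemma Room.corner (h : Room n v Q) {c p q u : ℤ × ℤ} (hc : c ∈ Q) (hd : Perp p q)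
    (hu : IsCorner u) : pt v (c + p + q, u) ∈ workspace n := by
  rw [add_assoc]
  refine h c hc _ ?_ ?_ u hu <;> rcases hd.isCorner with ⟨h1 | h1, h2 | h2⟩ <;> simp [h1, h2]

/-- A new tile hovers at a free position whose neighbouring cells are free. -/
lemma Hover.corridor {A : Set ((ℤ × ℤ) × (ℤ × ℤ))} {c m q : ℤ × ℤ} {s : (ℤ × ℤ) × (ℤ × ℤ)}
    (hA : ∀ t ∈ A, t.1 ∈ Q ∧ IsCorner t.2) (hm : Perp m q) (hroom : Room n v Q) (hc : c ∈ Q)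
    (hcm : c + m ∉ Q) (hd : c + m + q ∉ Q) (hs : Hover n v A s)
    (hadj : gridGraph.Adj (pt v s) (pt v (c + m, -m + q))) (ht : (c, m + q) ∉ A) :
    Hover n v A (c + m, -m + q) := by
  refine hs.step (fun t ht => (hA t ht).2) hm.neg_left hadj
    (hroom.dir hc hm.1 hm.neg_left.isCorner) ?_ ?_ ?_ ?_ ?_
  · exact fun h => hcm (hA _ h).1
  · exact fun h => hcm (hA _ h).1
  · exact fun h => hcm (hA _ h).1
  · simpa using ht
  · exact fun h => hd (hA _ h).1

/-- Conditional form of `Buildable.of_diff`. -/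
lemma Buildable.of_sep {S : Set ((ℤ × ℤ) × (ℤ × ℤ))} {t : (ℤ × ℤ) × (ℤ × ℤ)} {C : Prop}
    (hS : ∀ t ∈ S, IsCorner t.2) (h : Buildable n v {t' ∈ S | ¬ (t' = t ∧ C)})
    (hw : pt v t ∈ workspace n)
    (H : C → t ∈ S → (∃ s, Hover n v {t' ∈ S | ¬ (t' = t ∧ C)} s ∧
      gridGraph.Adj (pt v s) (pt v t)) ∧
      ∃ r ∈ S, r ≠ t ∧ gridGraph.Adj (pt v t) (pt v r)) : Buildable n v S := by
  by_cases hC : C ∧ t ∈ S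
  · obtain ⟨⟨s, hs, hst⟩, r, hr, hrt, hadj⟩ := H hC.1 hC.2
    have e : {t' ∈ S | ¬ (t' = t ∧ C)} = S \ {t} := by
      ext t'; simp [hC.1]
    rw [e] at h hs
    exact Buildable.of_diff hS h hw hs hst hr hrt hadj
  · convert h using 1
    ext t'
    constructor
    · exact fun ht' => ⟨ht', fun hh => hC ⟨hh.2, hh.1 ▸ ht'⟩⟩
    · exact fun ht' => ht'.1

lemma Perp.ne_flip {p q : ℤ × ℤ} (h : Perp p q) : -p + q ≠ p + q := by
  intro he
  exact h.1.ne_neg (by simpa using he.symm)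

lemma Perp.eq_cw_or {m q : ℤ × ℤ} (h : Perp m q) : q = cw m ∨ q = -cw m := h.2

/-- Only the two corners of `c` on the side `m` are affected, each only if its diagonal cell is
free. The nested form lets them be put back one at a time. -/
lemma tiles_sweep {σ σ' : ℤ × ℤ → ℤ × ℤ → Prop} {c m : ℤ × ℤ} (hm : IsDir m)
    (hσ' : ∀ c' d, σ' c' d ↔ σ c' d ∨ (c' = c ∧ d = m)) (hc : c ∈ Q) :
    tiles Q σ' = {t ∈ {t ∈ tiles Q σ | ¬ (t = (c, m + -cw m) ∧ c + m + -cw m ∉ Q)} |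
      ¬ (t = (c, m + cw m) ∧ c + m + cw m ∉ Q)} := by
  have key : ∀ p q, Perp p q → p = m → ((c, p + q) ∈ tiles Q σ' ↔ (c, p + q) ∈ tiles Q σ ∧
      ¬ ((c, p + q) = (c, m + -cw m) ∧ c + m + -cw m ∉ Q) ∧
      ¬ ((c, p + q) = (c, m + cw m) ∧ c + m + cw m ∉ Q)) := by
    rintro p q hpq rfl
    rw [mem_tiles hpq, mem_tiles hpq, hσ']
    have c3 : p + cw p ≠ p + -cw p := fun h => hm.rot.ne_neg (by simpa using h)
    rcases hpq.2 with rfl | rfl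
    · by_cases h : c + p + cw p ∈ Q <;> simp [h, hc, c3]
    · by_cases h : c + p + -cw p ∈ Q <;> simp [h, hc, c3.symm]
  refine tiles_ext isCorner_of_mem_tiles (fun t ht => ht.1.1.2.1) fun c' p q hpq => ?_
  rw [Set.mem_ofPred_eq, Set.mem_ofPred_eq, and_assoc]
  by_cases hcc : c' = c
  · subst hcc
    by_cases hpm : p = m
    · exact key p q hpq hpm
    · by_cases hqm : q = m
      · rw [add_comm p q]
        exact key q p hpq.symm hqm
      · have h1 : ∀ d, Perp m d → p + q ≠ m + d := fun d hd he => by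
          rcases hpq.add_inj hd he with h | h
          exacts [hpm h.1, hqm h.2]
        simp [mem_tiles hpq, hσ', hpm, hqm, h1 _ hm.perp, h1 _ hm.perp.neg_right]
  · simp [mem_tiles hpq, hσ', hcc]

/-- The tiles along a newly passed side can be removed. -/
lemma sweep_side {σ σ' : ℤ × ℤ → ℤ × ℤ → Prop} {c m : ℤ × ℤ} (hm : IsDir m)
    (hσ' : ∀ c' d, σ' c' d ↔ σ c' d ∨ (c' = c ∧ d = m)) (hroom : Room n v Q) (hc : c ∈ Q)
    (hcm : c + m ∉ Q)
    (ha : c + m + -cw m ∉ Q → ∃ s, Hover n v (tiles Q σ) s ∧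
      gridGraph.Adj (pt v s) (pt v (c + m, -m + -cw m)))
    (hb : c + m + -cw m ∈ Q → c + m + cw m ∉ Q → ∃ s, Hover n v (tiles Q σ) s ∧
      gridGraph.Adj (pt v s) (pt v (c + m, -m + cw m)))
    (ha' : c + m + -cw m ∉ Q → (c, m + -cw m) ∈ tiles Q σ → (c, -m + -cw m) ∈ tiles Q σ)
    (hb' : (c, -m + cw m) ∈ tiles Q σ) :
    tiles Q σ' ⊆ tiles Q σ ∧
    (∀ q, Perp m q → c + m + q ∉ Q → Hover n v (tiles Q σ') (c + m, -m + q)) ∧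
    (Buildable n v (tiles Q σ') → Buildable n v (tiles Q σ)) := by
  have hp := hm.perp
  have hp' := hp.neg_right
  set T := tiles Q σ with hT
  set T1 := {t ∈ T | ¬ (t = (c, m + -cw m) ∧ c + m + -cw m ∉ Q)} with hT1
  have hTc : ∀ t ∈ T, t.1 ∈ Q ∧ IsCorner t.2 := fun t ht => ⟨ht.1, ht.2.1⟩
  have hT1c : ∀ t ∈ T1, t.1 ∈ Q ∧ IsCorner t.2 := fun t ht => hTc t ht.1
  have e : tiles Q σ' = {t ∈ T1 | ¬ (t = (c, m + cw m) ∧ c + m + cw m ∉ Q)} := by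
    rw [tiles_sweep hm hσ' hc]
  have hsub1 : T1 ⊆ T := fun t ht => ht.1
  have hsub2 : tiles Q σ' ⊆ T1 := by rw [e]; exact fun t ht => ht.1
  have hA : c + m + -cw m ∉ Q → Hover n v T1 (c + m, -m + -cw m) := by
    intro hq
    obtain ⟨s, hs, hadj⟩ := ha hq
    exact (hs.mono hsub1).corridor hT1c hp' hroom hc hcm hq hadj (fun h => h.2 ⟨rfl, hq⟩)
  have hB : c + m + cw m ∉ Q → Hover n v (tiles Q σ') (c + m, -m + cw m) := by
    intro hq
    -- If the first corner is blocked by its diagonal cell, the lane is entered as `hb` provides;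
    -- otherwise the tile slides along from the first corner.
    have : ∃ s, Hover n v T1 s ∧ gridGraph.Adj (pt v s) (pt v (c + m, -m + cw m)) := by
      by_cases h : c + m + -cw m ∈ Q
      · obtain ⟨s, hs, hadj⟩ := hb h hq
        exact ⟨s, hs.mono hsub1, hadj⟩
      · refine ⟨_, hA h, ?_⟩
        have := adj_flip' hp'.neg_left v (c + m)
        rwa [neg_neg] at this
    obtain ⟨s, hs, hadj⟩ := this
    exact (hs.mono hsub2).corridor (fun t ht => hT1c t (hsub2 ht)) hp hroom hc hcm hq hadj
      (fun h => by rw [e] at h; exact h.2 ⟨rfl, hq⟩)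
  refine ⟨hsub2.trans hsub1, fun q hq hd => ?_, fun h => ?_⟩
  · rcases hq.eq_cw_or with rfl | rfl
    · exact hB hd
    · exact (hA hd).mono hsub2
  · refine Buildable.of_sep (t := (c, m + -cw m)) (C := c + m + -cw m ∉ Q)
      (fun t ht => (hTc t ht).2) ?_ (hroom.self hc hp'.isCorner) ?_
    · rw [e] at h
      refine Buildable.of_sep (fun t ht => (hT1c t ht).2) h (hroom.self hc hp.isCorner) ?_
      intro hq _
      refine ⟨⟨_, e ▸ hB hq, ?_⟩, (c, -m + cw m), ⟨hb', ?_⟩, ?_, adj_flip hp v c⟩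
      · have := adj_out hp.neg_left v (c + m)
        simpa using this
      · rintro ⟨h, -⟩
        have := (hp.neg_left.add_inj hp' (by simpa using h))
        rcases this with ⟨h, -⟩ | ⟨h, -⟩
        · exact hm.ne_neg h.symm
        · exact hm.ne_cw (by simpa using h)
      · simpa using hp.ne_flip
    · intro hq ht
      refine ⟨⟨_, hA hq, ?_⟩, (c, -m + -cw m), ha' hq ht, ?_, adj_flip hp' v c⟩
      · have := adj_out hp'.neg_left v (c + m)
        simpa using this
      · simpa using hp'.ne_flip

end

/-- A partially disassembled shape: new tiles can hover along all the sides passed by the walk. -/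
structure State (n : ℕ) (v r : ℤ × ℤ) (Q : Finset (ℤ × ℤ)) (k : ℕ) (b x : ℕ → ℤ × ℤ)
    (i : ℕ → ℕ) : Prop where
  shape : Shape r Q
  walk : Walk r Q k b x i
  room : Room n v Q
  start : Hover n v (tiles Q (Passed k b x i)) (r + (0, 1), (0, 1) + (-1, 0))
  corridor : ∀ j ≤ k, ∀ s, 1 ≤ s → s ≤ i j → ∀ q, Perp (cw^[s] (x j)) q →
    b j + cw^[s] (x j) + q ∉ Q →
    Hover n v (tiles Q (Passed k b x i)) (b j + cw^[s] (x j), -cw^[s] (x j) + q)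

lemma passed_update {k : ℕ} {b x : ℕ → ℤ × ℤ} {i : ℕ → ℕ} (c d : ℤ × ℤ) :
    Passed k b x (Function.update i k (i k + 1)) c d ↔
      Passed k b x i c d ∨ (c = b k ∧ d = cw^[i k + 1] (x k)) := by
  constructor
  · rintro ⟨j, hj, hc, s, h1, h2, hd⟩
    by_cases hjk : j = k
    · subst hjk
      rw [Function.update_self] at h2
      by_cases hs : s = i j + 1
      · subst hs; exact Or.inr ⟨hc, hd⟩
      · exact Or.inl ⟨j, hj, hc, s, h1, by omega, hd⟩
    · rw [Function.update_of_ne hjk] at h2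
      exact Or.inl ⟨j, hj, hc, s, h1, h2, hd⟩
  · rintro (⟨j, hj, hc, s, h1, h2, hd⟩ | ⟨hc, hd⟩)
    · refine ⟨j, hj, hc, s, h1, ?_, hd⟩
      by_cases hjk : j = k
      · subst hjk; rw [Function.update_self]; omega
      · rwa [Function.update_of_ne hjk]
    · exact ⟨k, le_rfl, hc, i k + 1, by omega, by rw [Function.update_self], hd⟩

lemma Walk.update {r : ℤ × ℤ} {Q : Finset (ℤ × ℤ)} {k : ℕ} {b x : ℕ → ℤ × ℤ} {i : ℕ → ℕ}
    (h : Walk r Q k b x i) (hi : i k ≤ 1) (hc : b k + cw^[i k + 1] (x k) ∉ Q) :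
    Walk r Q k b x (Function.update i k (i k + 1)) where
  b_zero := h.b_zero
  x_zero := h.x_zero
  inj := h.inj
  mem := h.mem
  le_two j hj := by
    by_cases hjk : j = k
    · subst hjk; rw [Function.update_self]; omega
    · rw [Function.update_of_ne hjk]; exact h.le_two j hj
  free j hj s h1 h2 := by
    by_cases hjk : j = k
    · subst hjk
      rw [Function.update_self] at h2
      by_cases hs : s = i j + 1
      · subst hs; exact hc
      · exact h.free j hj s h1 (by omega)
    · rw [Function.update_of_ne hjk] at h2; exact h.free j hj s h1 h2
  b_succ j hj := by rw [Function.update_of_ne (by omega)]; exact h.b_succ j hj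
  x_succ j hj := by rw [Function.update_of_ne (by omega)]; exact h.x_succ j hj

namespace State

variable {n : ℕ} {v r : ℤ × ℤ} {Q : Finset (ℤ × ℤ)} {k : ℕ} {b x : ℕ → ℤ × ℤ} {i : ℕ → ℕ}

/-- As the left rear cell is free, the walk did not turn left just before, and the lane along the
last side passed at the preceding cell ends beside the new side. At the root, the start position
plays this role. -/
lemma hover_first (h : State n v r Q k b x i) (hc : b k + cw (x k) ∉ Q)
    (hd : b k + cw (x k) + x k ∉ Q) : ∃ s, Hover n v (tiles Q (Passed k b x i)) s ∧
      gridGraph.Adj (pt v s) (pt v (b k + cw (x k), -cw (x k) + x k)) := by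
  have hx := h.walk.isDir k le_rfl
  rcases k with _ | j
  · refine ⟨_, h.start, ?_⟩
    rw [h.walk.x_zero, h.walk.b_zero]
    exact adj_flip (p := (0, 1)) (q := (-1, 0)) (by simp [Perp, IsDir, cw]) v _
  have hb := h.walk.b_add_x (j := j) (by omega)
  have hxj := h.walk.x_succ j (by omega)
  have e : cw (x (j + 1)) = cw^[i j] (x j) := by
    rw [hxj, Function.iterate_succ_apply', cw_neg, cw_cw, neg_neg]
  have hij : 1 ≤ i j := by
    by_contra h0
    rcases j with _ | j
    · exact h0 (h.walk.one_le_i_zero h.shape (by omega))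
    · rw [add_right_comm, hb, e, show i (j + 1) = 0 by omega] at hd
      exact hd (h.walk.b_add_x_mem (by omega) (by omega))
  have e2 : b (j + 1) + cw (x (j + 1)) = b j + cw (x (j + 1)) + -x (j + 1) := by
    rw [← hb]; abel
  have hp : Perp (cw (x (j + 1))) (-x (j + 1)) := hx.perp.symm.neg_right
  have := h.corridor j (by omega) (i j) hij le_rfl (-x (j + 1)) (by rw [← e]; exact hp)
    (by rw [← e, ← e2]; exact hc)
  rw [← e] at this
  refine ⟨_, this, ?_⟩
  rw [e2]
  simpa using adj_out' hp.neg_left v (b j + cw (x (j + 1)))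

/-- At a concave corner the free cell `C` on the left is bordered behind by an earlier cell `b j`,
whose lane leads into `C`; the tile crosses the far part of `C`. If `C` is also closed on the far
side, that border is a still earlier cell `b j'` of the walk, whose lane is used instead. -/
lemma hover_first' (h : State n v r Q k b x i) (hc : b k + cw (x k) ∉ Q)
    (hd : b k + cw (x k) + x k ∈ Q) (hd' : b k + cw (x k) + -x k ∉ Q) :
    ∃ s, Hover n v (tiles Q (Passed k b x i)) s ∧
      gridGraph.Adj (pt v s) (pt v (b k + cw (x k), -cw (x k) + -x k)) := by
  have hx := h.walk.isDir k le_rfl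
  obtain ⟨j, hjk, -, hbj, hij, hxj⟩ := h.walk.concave h.shape le_rfl hc hd
  have hbk := h.walk.mem k le_rfl
  have hp : Perp (-x k) (cw (x k)) := hx.perp.neg_left
  set C := b k + cw (x k) with hC
  have e1 : b j + -x k = C := by rw [hbj]; abel
  by_cases hm : C + cw (x k) ∈ Q
  · have hij2 := h.walk.le_two j (by omega)
    have : i j = 1 ∨ i j = 2 := by omega
    rcases this with h1 | h1
    · rw [h1, Function.iterate_one] at hxj
      have hxj' : x j = cw (x k) := by
        have := congrArg cw hxj
        rwa [cw_cw, cw_neg, neg_inj] at this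
      obtain ⟨j', hjj, -, hbj', hij', hxj''⟩ := h.walk.concave h.shape (j := j) (by omega)
        (by rw [hxj, e1]; exact hc) (by rw [hxj, e1, hxj']; exact hm)
      rw [hxj, e1, hxj'] at hbj'
      have e3 : b j' + -cw (x k) = C := by rw [hbj']; abel
      have hp2 : Perp (-cw (x k)) (-x k) := hx.perp.symm.neg_left.neg_right
      have := h.corridor j' (by omega) (i j') hij' le_rfl (-x k) (by rw [hxj'', hxj']; exact hp2)
        (by rw [hxj'', hxj', e3]; exact hd')
      rw [hxj'', hxj', e3] at this
      exact ⟨_, this, by simpa using adj_flip hp2.neg_left v C⟩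
    · exfalso
      rw [h1, cw_iterate_two, neg_inj] at hxj
      have h2 := h.walk.free j (by omega) 1 le_rfl (by omega)
      rw [Function.iterate_one, hxj] at h2
      exact h2 (h.shape.diag (p := -x k) hp (h.walk.mem j (by omega)) (by rwa [e1])
        (by rwa [e1]))
  · have := h.corridor j (by omega) (i j) hij le_rfl (cw (x k)) (by rw [hxj]; exact hp)
        (by rw [hxj, e1]; exact hm)
    rw [hxj, e1] at this
    have h2 := this.step (c := C) isCorner_of_mem_tiles hp
      (by simpa using adj_flip hp.neg_left v C)
      (h.room.dir hbk hx.rot hp.isCorner) (fun h => hc h.1) (fun h => hc h.1) (fun h => hc h.1)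
      (fun h => hd' h.1) (fun h => hm h.1)
    refine ⟨_, h2, ?_⟩
    have := adj_flip' hp v C
    rwa [add_comm (-x k) (-_)] at this

/-- The tile rounds a convex corner through the diagonal cell, which is free by non-degeneracy. -/
lemma hover_second (h : State n v r Q k b x i) (hi : i k = 1) (hc : b k + -x k ∉ Q) :
    b k + -x k + cw (x k) ∉ Q ∧ ∃ s, Hover n v (tiles Q (Passed k b x i)) s ∧
      gridGraph.Adj (pt v s) (pt v (b k + -x k, x k + cw (x k))) := by
  have hx := h.walk.isDir k le_rfl
  have hbk := h.walk.mem k le_rfl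
  have h1 := h.walk.free k le_rfl 1 le_rfl hi.ge
  rw [Function.iterate_one] at h1
  have hp : Perp (cw (x k)) (-x k) := hx.perp.symm.neg_right
  have hd : b k + cw (x k) + -x k ∉ Q := fun hd => hc (h.shape.diag hp hbk h1 hd)
  refine ⟨by rwa [add_right_comm], ?_⟩
  have h2 := h.corridor k le_rfl 1 le_rfl hi.ge (-x k) (by simpa using hp) (by simpa using hd)
  rw [Function.iterate_one] at h2
  have hp2 := hp.neg_left.neg_right
  rw [neg_neg] at hp2
  have h3 := h2.step (c := b k + cw (x k) + -x k) isCorner_of_mem_tiles hp2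
    (by simpa using adj_out' hp.neg_left v (b k + cw (x k)))
    (h.room.corner hbk hp hp2.isCorner) (fun h => hd h.1) (fun h => hd h.1) (fun h => hd h.1)
    (fun h => hc (by have := h.1; rwa [add_right_comm, add_neg_cancel_right] at this))
    (fun h => h1 (by have := h.1; rwa [neg_add_cancel_right] at this))
  refine ⟨_, h3, ?_⟩
  have := adj_out hp2 v (b k + cw (x k) + -x k)
  rw [neg_neg, add_comm (cw (x k)) (x k)] at this
  convert this using 3
  abel

/-- The walk can pass the next free side of its last cell. -/
lemma sweep (h : State n v r Q k b x i) (hi : i k ≤ 1) (hc : b k + cw^[i k + 1] (x k) ∉ Q) :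
    State n v r Q k b x (Function.update i k (i k + 1)) ∧
    (Buildable n v (tiles Q (Passed k b x (Function.update i k (i k + 1)))) →
      Buildable n v (tiles Q (Passed k b x i))) := by
  have hx := h.walk.isDir k le_rfl
  have hbk := h.walk.mem k le_rfl
  have key := sweep_side (hx.iterate (i k + 1)) passed_update h.room hbk hc
  have hnp : ∀ d, (∀ s, 1 ≤ s → s ≤ i k → d ≠ cw^[s] (x k)) → ¬ Passed k b x i (b k) d := by
    intro d hd
    rw [h.walk.passed_iff le_rfl]
    rintro ⟨s, h1, h2, h3⟩
    exact hd s h1 h2 h3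
  obtain ⟨k1, k2, k3⟩ := by
    apply key
    · intro hd
      have : i k = 0 ∨ i k = 1 := by omega
      rcases this with h0 | h0
      · simp only [h0, zero_add, Function.iterate_one, cw_cw, neg_neg] at hd hc ⊢
        exact h.hover_first hc hd
      · simp only [h0, Nat.reduceAdd, cw_iterate_two, cw_neg, neg_neg] at hd hc ⊢
        exact (h.hover_second h0 hc).2
    · intro hd hd'
      have : i k = 0 ∨ i k = 1 := by omega
      rcases this with h0 | h0
      · simp only [h0, zero_add, Function.iterate_one, cw_cw, neg_neg] at hd hd' hc ⊢
        exact h.hover_first' hc hd hd'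
      · simp only [h0, Nat.reduceAdd, cw_iterate_two, cw_neg, neg_neg] at hd hc ⊢
        exact absurd hd (h.hover_second h0 hc).1
    · intro hd ht
      have : i k = 0 ∨ i k = 1 := by omega
      rcases this with h0 | h0
      · rw [mem_tiles (hx.iterate _).perp.neg_left.neg_right]
        exact ⟨hbk, Or.inr ⟨hnp _ fun s _ _ => by omega, hnp _ fun s _ _ => by omega⟩⟩
      · simp only [h0, Nat.reduceAdd, cw_iterate_two, cw_neg, neg_neg] at hd hc ht
        rw [mem_tiles hx.perp.neg_left] at ht
        -- The tile between the two sides was already stripped with the first one.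
        exfalso
        rcases ht.2 with h1 | h1
        · exact hd h1
        · exact h1.2 ((h.walk.passed_iff le_rfl).2 ⟨1, le_rfl, h0.ge, by simp⟩)
    · rw [mem_tiles (hx.iterate _).perp.neg_left]
      have : i k = 0 ∨ i k = 1 := by omega
      rcases this with h0 | h0
      · exact ⟨hbk, Or.inr ⟨hnp _ fun s _ _ => by omega, hnp _ fun s _ _ => by omega⟩⟩
      · refine ⟨hbk, Or.inr ⟨hnp _ fun s h1 h2 => ?_, hnp _ fun s h1 h2 => ?_⟩⟩ <;>
          obtain rfl : s = 1 := by omega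
        · simpa [h0] using hx.ne_cw
        · simpa [h0, cw_neg] using hx.rot.ne_neg.symm
  refine ⟨⟨h.shape, h.walk.update hi hc, h.room, h.start.mono k1, ?_⟩, k3⟩
  intro j hj s h1 h2 q hq hd
  by_cases hjk : j = k ∧ s = i k + 1
  · obtain ⟨rfl, rfl⟩ := hjk
    exact k2 q hq hd
  · refine (h.corridor j hj s h1 ?_ q hq hd).mono k1
    by_cases hjk' : j = k
    · subst hjk'; rw [Function.update_self] at h2; omega
    · rwa [Function.update_of_ne hjk'] at h2

end State

/-! ### Removing cells at the end of the walk -/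

lemma IsCorner.cases_perp {u p q : ℤ × ℤ} (hu : IsCorner u) (h : Perp p q) :
    u = p + q ∨ u = -p + q ∨ u = p + -q ∨ u = -p + -q := by
  obtain ⟨a, b⟩ := u
  obtain ⟨rfl | rfl, rfl | rfl⟩ := hu <;>
  rcases h.cases with ⟨rfl, rfl⟩ | ⟨rfl, rfl⟩ | ⟨rfl, rfl⟩ | ⟨rfl, rfl⟩ | ⟨rfl, rfl⟩ | ⟨rfl, rfl⟩ |
    ⟨rfl, rfl⟩ | ⟨rfl, rfl⟩ <;> simp

/-- Only the surroundings of `Z` matter: a path meeting `Z` enters and leaves it through cells next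
to `Z`, and a diagonal pair is in danger only if its common neighbour lies in `Z`. -/
lemma Shape.remove {r : ℤ × ℤ} {Q Z : Finset (ℤ × ℤ)} (h : Shape r Q) (hr : r ∉ Z)
    (hconn : ∀ u ∈ Q \ Z, ∀ w ∈ Q \ Z, (∃ z ∈ Z, gridGraph.Adj u z) →
      (∃ z ∈ Z, gridGraph.Adj w z) →
      Relation.ReflTransGen (fun a b => b ∈ Q \ Z ∧ gridGraph.Adj a b) u w)
    (hnd : ∀ z ∈ Z, ∀ t₁ ∈ Q \ Z, ∀ t₂ ∈ Q \ Z, ShareCorner t₁ t₂ → gridGraph.Adj z t₁ →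
      gridGraph.Adj z t₂ → ∃ t ∈ Q \ Z, gridGraph.Adj t t₁ ∧ gridGraph.Adj t t₂) :
    Shape r (Q \ Z) where
  root := Finset.mem_sdiff.2 ⟨h.root, hr⟩
  conn c hc := by
    have key : ∀ u, Relation.ReflTransGen (fun a b => b ∈ Q ∧ gridGraph.Adj a b) r u →
        (u ∉ Z → Relation.ReflTransGen (fun a b => b ∈ Q \ Z ∧ gridGraph.Adj a b) r u) ∧
        (u ∈ Z → ∃ w ∈ Q \ Z, (∃ z ∈ Z, gridGraph.Adj w z) ∧
          Relation.ReflTransGen (fun a b => b ∈ Q \ Z ∧ gridGraph.Adj a b) r w) := by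
      intro u hu
      have hQ : ∀ u, Relation.ReflTransGen (fun a b => b ∈ Q ∧ gridGraph.Adj a b) r u →
          u ∈ Q := by
        intro u hu
        rcases Relation.ReflTransGen.cases_tail hu with rfl | ⟨w, -, hw, -⟩
        exacts [h.root, hw]
      induction hu with
      | refl => exact ⟨fun _ => .refl, fun h => absurd h hr⟩
      | tail hab hbc ih =>
        rename_i y z
        by_cases hy : y ∈ Z
        · obtain ⟨w, hw, hwz, hrw⟩ := ih.2 hy
          refine ⟨fun hz => ?_, fun _ => ⟨w, hw, hwz, hrw⟩⟩
          exact hrw.trans (hconn w hw z (Finset.mem_sdiff.2 ⟨hbc.1, hz⟩) hwz ⟨y, hy, hbc.2.symm⟩)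
        · have hry := ih.1 hy
          refine ⟨fun hz => hry.tail ⟨Finset.mem_sdiff.2 ⟨hbc.1, hz⟩, hbc.2⟩, fun hz => ?_⟩
          exact ⟨y, Finset.mem_sdiff.2 ⟨hQ y hab, hy⟩, ⟨z, hz, hbc.2⟩, hry⟩
    rw [Finset.mem_sdiff] at hc
    exact (key c (h.conn c hc.1)).1 hc.2
  nondeg t₁ h₁ t₂ h₂ hs := by
    obtain ⟨t, ht, ha, hb⟩ := h.nondeg t₁ (Finset.mem_sdiff.1 h₁).1 t₂ (Finset.mem_sdiff.1 h₂).1 hs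
    by_cases htZ : t ∈ Z
    · exact hnd t htZ t₁ h₁ t₂ h₂ hs ha hb
    · exact ⟨t, Finset.mem_sdiff.2 ⟨ht, htZ⟩, ha, hb⟩
  top c hc := h.top c (Finset.mem_sdiff.1 hc).1
  left hc := h.left (Finset.mem_sdiff.1 hc).1

lemma Walk.restrict {r : ℤ × ℤ} {Q Q' : Finset (ℤ × ℤ)} {k k' : ℕ} {b x : ℕ → ℤ × ℤ} {i : ℕ → ℕ}
    (h : Walk r Q k b x i) (hk : k' ≤ k) (hQ : Q' ⊆ Q) (hb : ∀ j ≤ k', b j ∈ Q') :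
    Walk r Q' k' b x i where
  b_zero := h.b_zero
  x_zero := h.x_zero
  inj j hj j' hj' := h.inj j (hj.trans hk) j' (hj'.trans hk)
  mem := hb
  le_two j hj := h.le_two j (hj.trans hk)
  free j hj s h1 h2 hm := h.free j (hj.trans hk) s h1 h2 (hQ hm)
  b_succ j hj := h.b_succ j (hj.trans_le hk)
  x_succ j hj := h.x_succ j (hj.trans_le hk)

lemma Walk.cw_x_succ {r : ℤ × ℤ} {Q : Finset (ℤ × ℤ)} {k : ℕ} {b x : ℕ → ℤ × ℤ} {i : ℕ → ℕ}
    (h : Walk r Q k b x i) {j : ℕ} (hj : j < k) : cw (x (j + 1)) = cw^[i j] (x j) := by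
  rw [h.x_succ j hj, Function.iterate_succ_apply', cw_neg, cw_cw, neg_neg]

/-- The left tile at the exit of a cell is gone unless the walk turns left there, and the cell
beyond it is free. -/
lemma Walk.left_free {r : ℤ × ℤ} {Q : Finset (ℤ × ℤ)} {k : ℕ} {b x : ℕ → ℤ × ℤ} {i : ℕ → ℕ}
    (h : Walk r Q k b x i) {j : ℕ} (hj : j < k) (h0 : i j ≠ 0) :
    b j + cw (x (j + 1)) ∉ Q ∧ Passed k b x i (b j) (cw (x (j + 1))) := by
  rw [h.cw_x_succ hj]
  exact ⟨h.free j hj.le _ (by omega) le_rfl, j, hj.le, rfl, i j, by omega, le_rfl, rfl⟩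

/-- The right tile at the exit of a cell is present. -/
lemma Walk.right_tile {r : ℤ × ℤ} {Q : Finset (ℤ × ℤ)} {k : ℕ} {b x : ℕ → ℤ × ℤ} {i : ℕ → ℕ}
    (h : Walk r Q k b x i) {j : ℕ} (hj : j < k) :
    (b j, -x (j + 1) + -cw (x (j + 1))) ∈ tiles Q (Passed k b x i) := by
  have hp : Perp (-x (j + 1)) (-cw (x (j + 1))) := (h.isDir (j + 1) hj).perp.neg_left.neg_right
  rw [mem_tiles hp]
  have e := h.x_succ j hj
  have e2 : -x (j + 1) = cw^[i j + 1] (x j) := by rw [e, neg_neg]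
  have e3 : -cw (x (j + 1)) = cw^[i j + 2] (x j) := by
    rw [e, Function.iterate_succ_apply' _ (i j + 1), cw_neg, neg_neg]
  rw [e2, e3]
  exact ⟨h.mem j hj.le, Or.inr (h.not_passed_exit hj.le)⟩

section

variable {n : ℕ} {v : ℤ × ℤ}

/-- Removal of a cell two of whose tiles are gone. -/
lemma remove_cell {A : Set ((ℤ × ℤ) × (ℤ × ℤ))} {c f l : ℤ × ℤ} {s : (ℤ × ℤ) × (ℤ × ℤ)}
    (hA : ∀ t ∈ A, IsCorner t.2) (hp : Perp f l)
    (hw : ∀ u, IsCorner u → pt v (c, u) ∈ workspace n)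
    (hs : Hover n v A s) (hadj : gridGraph.Adj (pt v s) (pt v (c, f + l)))
    (n1 : (c, f + l) ∉ A) (n2 : (c, -f + l) ∉ A) (n3 : ∀ u, (c + f, u) ∉ A)
    (n4 : ∀ u, (c + l, u) ∉ A) (n5 : (c + -f, f + l) ∉ A)
    (m1 : (c, -f + -l) ∈ A) (m2 : (c + -f, f + -l) ∈ A)
    (hB : Buildable n v {t ∈ A | t.1 ≠ c}) : Buildable n v A := by
  have e : {t ∈ A | t.1 ≠ c} = (A \ {(c, f + -l)}) \ {(c, -f + -l)} := by
    ext ⟨c', u⟩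
    simp only [Set.mem_ofPred_eq, Set.mem_sdiff, Set.mem_singleton_iff, Prod.mk.injEq]
    constructor
    · rintro ⟨h1, h2⟩
      exact ⟨⟨h1, fun h => h2 h.1⟩, fun h => h2 h.1⟩
    · rintro ⟨⟨h1, h2⟩, h3⟩
      refine ⟨h1, ?_⟩
      rintro rfl
      rcases (hA _ h1).cases_perp hp with h | h | h | h <;> simp only at h <;> subst h
      exacts [n1 h1, n2 h1, h2 ⟨rfl, rfl⟩, h3 ⟨rfl, rfl⟩]
  rw [e] at hB
  have hA1 : ∀ t ∈ A \ {(c, f + -l)}, IsCorner t.2 := fun t ht => hA t ht.1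
  have hf := hp.1
  have H1 : Hover n v (A \ {(c, f + -l)}) (c, f + l) :=
    (hs.mono Set.sdiff_subset).step hA1 hp hadj (hw _ hp.isCorner) (fun h => n1 h.1)
      (fun h => n2 h.1) (fun h => h.2 rfl) (fun h => n3 _ h.1) (fun h => n4 _ h.1)
  have H2 : Hover n v ((A \ {(c, f + -l)}) \ {(c, -f + -l)}) (c, -f + l) :=
    (H1.mono Set.sdiff_subset).step (fun t ht => hA1 t ht.1) hp.neg_left (adj_flip hp v c)
      (hw _ hp.neg_left.isCorner) (fun h => n2 h.1.1)
      (fun h => n1 (by simpa using h.1.1)) (fun h => h.2 rfl)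
      (fun h => n5 (by simpa using h.1.1)) (fun h => n4 _ h.1.1)
  -- The tile `(c, f + -l)` may be gone already, which `Buildable.of_diff` allows.
  refine Buildable.of_diff hA (t := (c, f + -l)) (r := (c, -f + -l)) ?_
    (hw _ hp.neg_right.isCorner) H1 (adj_flip' hp v c) m1 ?_ (adj_flip hp.neg_right v c)
  · refine Buildable.of_diff hA1 hB (hw _ hp.neg_left.neg_right.isCorner) H2
      (adj_flip' hp.neg_left v c) (r := (c + -f, f + -l)) ⟨m2, ?_⟩ ?_ ?_
    · simp [hf.ne_zero]
    · simp [hf.ne_zero]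
    · simpa using adj_out hp.neg_left.neg_right v c
  · simpa using hp.neg_right.ne_flip

end

namespace State

variable {n : ℕ} {v r : ℤ × ℤ} {Q : Finset (ℤ × ℤ)} {k : ℕ} {b x : ℕ → ℤ × ℤ} {i : ℕ → ℕ}

lemma passed_cell (_ : State n v r Q k b x i) {s : ℕ} (h1 : 1 ≤ s) (h2 : s ≤ i k) :
    Passed k b x i (b k) (cw^[s] (x k)) := ⟨k, le_rfl, rfl, s, h1, h2, rfl⟩

lemma corner_facts (h : State n v r Q k b x i) (hi : i k = 2) :
    b k + cw (x k) ∉ Q ∧ b k + -x k ∉ Q ∧ b k + -x k + cw (x k) ∉ Q ∧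
    b k + cw (x k) + -x k ∉ Q ∧ (b k, -x k + cw (x k)) ∉ tiles Q (Passed k b x i) := by
  have hx := h.walk.isDir k le_rfl
  have f1 := h.walk.free k le_rfl 1 le_rfl (by omega)
  have f2 := h.walk.free k le_rfl 2 (by omega) (by omega)
  rw [Function.iterate_one] at f1
  rw [cw_iterate_two] at f2
  have f3 : b k + -x k + cw (x k) ∉ Q := fun hd =>
    f1 (h.shape.diag hx.perp.neg_left (h.walk.mem k le_rfl) f2 hd)
  refine ⟨f1, f2, f3, by rwa [add_right_comm], ?_⟩
  rw [mem_tiles hx.perp.neg_left]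
  rintro ⟨-, h1 | h1⟩
  · exact f3 h1
  · exact h1.2 (by simpa using h.passed_cell le_rfl (by omega))

/-- Removal of the last cell of the walk if the walk turns right there and does not turn left just
before. -/
lemma remove_last {k : ℕ} (h : State n v r Q (k + 1) b x i) (hi : i (k + 1) = 2) (h0 : i k ≠ 0)
    (hB : Buildable n v {t ∈ tiles Q (Passed (k + 1) b x i) | t.1 ≠ b (k + 1)}) :
    Buildable n v (tiles Q (Passed (k + 1) b x i)) := by
  have hx := h.walk.isDir (k + 1) le_rfl
  have hb := h.walk.b_add_x (Nat.lt_succ_self k)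
  have hbk := h.walk.mem (k + 1) le_rfl
  obtain ⟨f1, f2, f3, f4, f5⟩ := h.corner_facts hi
  obtain ⟨g1, g2⟩ := h.walk.left_free (Nat.lt_succ_self k) h0
  have g3 := h.walk.right_tile (Nat.lt_succ_self k)
  have hs := h.corridor (k + 1) le_rfl 1 le_rfl (by omega) (-x (k + 1))
    (by simpa using hx.perp.symm.neg_right) (by simpa using f4)
  rw [Function.iterate_one] at hs
  have hp := hx.perp.neg_left
  refine remove_cell (s := _) isCorner_of_mem_tiles hp
    (fun u hu => h.room.self hbk hu) hs ?_ f5 ?_ (fun u hu => f2 hu.1) (fun u hu => f1 hu.1) ?_ ?_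
    ?_ hB
  · rw [add_comm (-x (k + 1)) (cw _)]
    simpa using adj_out hx.perp.symm.neg_right.neg_left v (b (k + 1) + cw (x (k + 1)))
  · rw [neg_neg, mem_tiles hx.perp]
    rintro ⟨-, h1 | h1⟩
    · rw [hb] at h1; exact g1 h1
    · exact h1.2 (by simpa using h.passed_cell le_rfl (by omega))
  · rw [neg_neg, hb, mem_tiles hp]
    rintro ⟨-, h1 | h1⟩
    · rw [← hb, add_neg_cancel_right] at h1; exact f1 h1
    · exact h1.2 g2
  · rw [neg_neg, mem_tiles hx.perp.neg_right]
    refine ⟨hbk, Or.inr ?_⟩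
    have := h.walk.not_passed_exit (j := k + 1) le_rfl
    rw [hi] at this
    simp only [Nat.reduceAdd, cw_iterate_three] at this
    rw [Function.iterate_succ_apply', cw_iterate_three, cw_neg, cw_cw, neg_neg] at this
    exact this.symm
  · rwa [neg_neg, hb]

/-- Removal of the last two cells of the walk. -/
lemma remove_two {k : ℕ} (h : State n v r Q (k + 2) b x i) (hi : i (k + 2) = 2)
    (h1 : i (k + 1) = 1) (h0 : i k ≠ 0)
    (hB : Buildable n v {t ∈ tiles Q (Passed (k + 2) b x i) | t.1 ≠ b (k + 2) ∧
      t.1 ≠ b (k + 1)}) :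
    Buildable n v (tiles Q (Passed (k + 2) b x i)) := by
  refine h.remove_last hi (by omega) ?_
  set T := tiles Q (Passed (k + 2) b x i) with hT
  have hx := h.walk.isDir (k + 1) (by omega)
  have hb := h.walk.b_add_x (show k < k + 2 by omega)
  have hb2 := h.walk.b_succ (k + 1) (by omega)
  rw [h1, cw_iterate_two] at hb2
  have hbk := h.walk.mem (k + 1) (by omega)
  obtain ⟨g1, g2⟩ := h.walk.left_free (show k < k + 2 by omega) h0
  have g3 := h.walk.right_tile (show k < k + 2 by omega)
  have f1 := h.walk.free (k + 1) (by omega) 1 le_rfl h1.ge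
  have f5 : b (k + 2) + cw (x (k + 1)) ∉ Q := by
    have := h.walk.free (k + 2) le_rfl 1 le_rfl (by omega)
    rw [Function.iterate_one, h.walk.x_succ (k + 1) (by omega), h1, cw_iterate_two, neg_neg] at this
    exact this
  rw [Function.iterate_one] at f1
  have f3 : b (k + 1) + -x (k + 1) + cw (x (k + 1)) ∉ Q := by rw [← hb2]; exact f5
  have f4 : b (k + 1) + cw (x (k + 1)) + -x (k + 1) ∉ Q := by rwa [add_right_comm]
  have hp := hx.perp.neg_left
  have hpa : Passed (k + 2) b x i (b (k + 1)) (cw (x (k + 1))) :=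
    ⟨k + 1, by omega, rfl, 1, le_rfl, h1.ge, rfl⟩
  have hs := h.corridor (k + 1) (by omega) 1 le_rfl h1.ge (-x (k + 1))
    (by simpa using hx.perp.symm.neg_right) (by simpa using f4)
  rw [Function.iterate_one] at hs
  have hne : ∀ j, j < k + 2 → b j ≠ b (k + 2) := fun j hj he => by
    have := h.walk.inj j (by omega) (k + 2) le_rfl he
    omega
  refine remove_cell (s := _) (fun t ht => ht.1.2.1) hp
    (fun u hu => h.room.self hbk hu) (hs.mono fun t ht => ht.1) ?_ ?_ ?_ ?_
    (fun u hu => f1 hu.1.1) ?_ ?_ ?_ ?_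
  · rw [add_comm (-x (k + 1)) (cw _)]
    simpa using adj_out hx.perp.symm.neg_right.neg_left v (b (k + 1) + cw (x (k + 1)))
  · rintro ⟨ht, -⟩
    rw [hT, mem_tiles hp] at ht
    rcases ht.2 with h1 | h1
    exacts [f3 h1, h1.2 hpa]
  · rintro ⟨ht, -⟩
    rw [hT, neg_neg, mem_tiles hx.perp, hb] at ht
    rcases ht.2 with h1 | h1
    exacts [g1 h1, h1.2 hpa]
  · rintro u ⟨-, ht⟩
    exact ht hb2.symm
  · rintro ⟨ht, -⟩
    rw [hT, neg_neg, hb, mem_tiles hp, ← hb, add_neg_cancel_right, hb] at ht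
    rcases ht.2 with h1 | h1
    exacts [f1 h1, h1.2 g2]
  · refine ⟨?_, hne _ (by omega)⟩
    rw [hT, neg_neg, mem_tiles hx.perp.neg_right]
    refine ⟨hbk, Or.inr ?_⟩
    rw [h.walk.passed_iff (show k + 1 ≤ k + 2 by omega),
      h.walk.passed_iff (show k + 1 ≤ k + 2 by omega), h1]
    constructor <;> rintro ⟨s, s1, s2, s3⟩ <;> obtain rfl : s = 1 := by omega
    · exact hx.ne_cw s3
    · exact hx.rot.ne_neg s3.symm
  · rw [neg_neg, hb]
    exact ⟨g3, hne _ (by omega)⟩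
  · convert hB using 1
    ext t
    simp only [Set.mem_ofPred_eq, and_assoc]

end State

/-- Removing `Z` frees diagonal cells: a tile on a passed side that was kept because of a diagonal
cell in `Z` is released, that is, it must go as well. -/
lemma mem_tiles_sdiff {Q Z : Finset (ℤ × ℤ)} {σ σ' : ℤ × ℤ → ℤ × ℤ → Prop} {c p q : ℤ × ℤ}
    (h : Perp p q) (hσ : c ∉ Z → ∀ d, σ' c d ↔ σ c d) :
    (c, p + q) ∈ tiles (Q \ Z) σ' ↔ ((c, p + q) ∈ tiles Q σ ∧ c ∉ Z) ∧
      ¬ (c + p + q ∈ Z ∧ (σ c p ∨ σ c q)) := by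
  rw [mem_tiles h, mem_tiles h, Finset.mem_sdiff, Finset.mem_sdiff]
  by_cases hc : c ∈ Z
  · simp [hc]
  · rw [hσ hc, hσ hc]
    tauto

/-- The cells of the walk after the `k'`-th one. -/
def tail (b : ℕ → ℤ × ℤ) (k' k : ℕ) : Finset (ℤ × ℤ) := (Finset.Ioc k' k).image b

lemma mem_tail {b : ℕ → ℤ × ℤ} {k' k : ℕ} {z : ℤ × ℤ} :
    z ∈ tail b k' k ↔ ∃ j, k' < j ∧ j ≤ k ∧ b j = z := by
  simp [tail, and_assoc]

lemma mem_tail_one {b : ℕ → ℤ × ℤ} {k : ℕ} {z : ℤ × ℤ} :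
    z ∈ tail b k (k + 1) ↔ z = b (k + 1) := by
  rw [mem_tail]
  constructor
  · rintro ⟨j, h1, h2, rfl⟩
    obtain rfl : j = k + 1 := by omega
    rfl
  · rintro rfl
    exact ⟨k + 1, by omega, le_rfl, rfl⟩

lemma mem_tail_two {b : ℕ → ℤ × ℤ} {k : ℕ} {z : ℤ × ℤ} :
    z ∈ tail b k (k + 2) ↔ z = b (k + 2) ∨ z = b (k + 1) := by
  rw [mem_tail]
  constructor
  · rintro ⟨j, h1, h2, rfl⟩
    obtain rfl | rfl : j = k + 2 ∨ j = k + 1 := by omega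
    exacts [Or.inl rfl, Or.inr rfl]
  · rintro (rfl | rfl)
    exacts [⟨k + 2, by omega, le_rfl, rfl⟩, ⟨k + 1, by omega, by omega, rfl⟩]

lemma passed_restrict {k' k : ℕ} {b x : ℕ → ℤ × ℤ} {i : ℕ → ℕ} {c : ℤ × ℤ} (hk : k' ≤ k)
    (hc : c ∉ tail b k' k) (d : ℤ × ℤ) : Passed k' b x i c d ↔ Passed k b x i c d := by
  constructor
  · rintro ⟨j, hj, H⟩
    exact ⟨j, hj.trans hk, H⟩
  · rintro ⟨j, hj, he, H⟩
    refine ⟨j, ?_, he, H⟩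
    by_contra hlt
    exact hc (mem_tail.2 ⟨j, by omega, hj, he.symm⟩)

namespace State

variable {n : ℕ} {v r : ℤ × ℤ} {Q : Finset (ℤ × ℤ)} {k : ℕ} {b x : ℕ → ℤ × ℤ} {i : ℕ → ℕ}

lemma notMem_tail (h : State n v r Q k b x i) {k' j : ℕ} (hk : k' ≤ k) (hj : j ≤ k') :
    b j ∉ tail b k' k := by
  rw [mem_tail]
  rintro ⟨j', h1, h2, h3⟩
  have := h.walk.inj _ h2 _ (hj.trans hk) h3
  omega

/-- Old lanes stay clear because the tile set shrinks. New spots arise only where the diagonal cell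
has been removed, and `hco` supplies these. -/
lemma restrict (h : State n v r Q k b x i) {k' : ℕ} (hk : k' ≤ k)
    (hs : Shape r (Q \ tail b k' k))
    (hco : ∀ j ≤ k', ∀ s, 1 ≤ s → s ≤ i j → ∀ q, Perp (cw^[s] (x j)) q →
      b j + cw^[s] (x j) + q ∈ tail b k' k →
      Hover n v (tiles (Q \ tail b k' k) (Passed k' b x i))
        (b j + cw^[s] (x j), -cw^[s] (x j) + q)) :
    State n v r (Q \ tail b k' k) k' b x i := by
  have hsub : tiles (Q \ tail b k' k) (Passed k' b x i) ⊆ tiles Q (Passed k b x i) := by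
    rintro ⟨c, u⟩ ht
    obtain ⟨p, q, hpq, rfl⟩ := ht.2.1.exists_perp
    exact ((mem_tiles_sdiff hpq fun hc => passed_restrict hk hc).1 ht).1.1
  refine ⟨hs, h.walk.restrict hk Finset.sdiff_subset fun j hj => Finset.mem_sdiff.2
    ⟨h.walk.mem j (hj.trans hk), h.notMem_tail hk hj⟩, fun c hc => h.room c
    (Finset.mem_sdiff.1 hc).1, h.start.mono hsub, fun j hj s h1 h2 q hq hd => ?_⟩
  by_cases hd' : b j + cw^[s] (x j) + q ∈ Q
  · refine hco j hj s h1 h2 q hq ?_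
    by_contra hn
    exact hd (Finset.mem_sdiff.2 ⟨hd', hn⟩)
  · exact (h.corridor j (hj.trans hk) s h1 h2 q hq hd').mono hsub

lemma restrict_of_no_release (h : State n v r Q k b x i) {k' : ℕ} (hk : k' ≤ k)
    (hs : Shape r (Q \ tail b k' k))
    (hno : ∀ j ≤ k', ∀ s, 1 ≤ s → s ≤ i j → ∀ q, Perp (cw^[s] (x j)) q →
      b j + cw^[s] (x j) + q ∉ tail b k' k) :
    State n v r (Q \ tail b k' k) k' b x i ∧ tiles (Q \ tail b k' k) (Passed k' b x i) =
      {t ∈ tiles Q (Passed k b x i) | t.1 ∉ tail b k' k} := by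
  refine ⟨h.restrict hk hs fun j hj s h1 h2 q hq hd => absurd hd (hno j hj s h1 h2 q hq), ?_⟩
  refine tiles_ext isCorner_of_mem_tiles (fun t ht => ht.1.2.1) fun c p q hpq => ?_
  rw [mem_tiles_sdiff hpq fun hc => passed_restrict hk hc]
  refine and_iff_left_of_imp fun ht => ?_
  have key : ∀ p q, Perp p q → c + p + q ∈ tail b k' k → ¬ Passed k b x i c p := by
    intro p q hpq hd hpa
    rw [← passed_restrict hk ht.2] at hpa
    obtain ⟨j, hj, rfl, s, h1, h2, rfl⟩ := hpa
    exact hno j hj s h1 h2 q hpq hd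
  rintro ⟨hd, hpa | hpa⟩
  · exact key p q hpq hd hpa
  · exact key q p hpq.symm (by rwa [add_right_comm]) hpa

/-- The last cell is removed after a right turn that does not follow a left turn. -/
lemma pop_one {k : ℕ} (h : State n v r Q (k + 1) b x i) (hi : i (k + 1) = 2) (h0 : i k ≠ 0)
    (hs : Shape r (Q \ tail b k (k + 1))) :
    State n v r (Q \ tail b k (k + 1)) k b x i ∧
      (Buildable n v (tiles (Q \ tail b k (k + 1)) (Passed k b x i)) →
        Buildable n v (tiles Q (Passed (k + 1) b x i))) := by
  obtain ⟨H, e⟩ := h.restrict_of_no_release (k' := k) (by omega) hs (by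
    intro j hj s h1 h2 q hq hd
    obtain ⟨j', a1, a2, a3⟩ := mem_tail.1 hd
    obtain rfl : j' = k + 1 := by omega
    obtain ⟨a4, a5, -⟩ := h.walk.release h.shape (by omega) h1 h2 hq a3.symm
    obtain rfl : j + 1 = k := by omega
    exact h0 a5)
  refine ⟨H, fun hB => h.remove_last hi h0 ?_⟩
  rw [e] at hB
  simpa only [mem_tail_one] using hB

/-- By `Walk.release`, a tile released by one of the two cells would require a left turn at `b k` or
`b (k + 1)`. Both are excluded. -/
lemma pop_two {k : ℕ} (h : State n v r Q (k + 2) b x i) (hi : i (k + 2) = 2)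
    (h1 : i (k + 1) = 1) (h0 : i k ≠ 0) (hs : Shape r (Q \ tail b k (k + 2))) :
    State n v r (Q \ tail b k (k + 2)) k b x i ∧
      (Buildable n v (tiles (Q \ tail b k (k + 2)) (Passed k b x i)) →
        Buildable n v (tiles Q (Passed (k + 2) b x i))) := by
  obtain ⟨H, e⟩ := h.restrict_of_no_release (k' := k) (by omega) hs (by
    intro j hj s s1 s2 q hq hd
    obtain ⟨j', a1, a2, a3⟩ := mem_tail.1 hd
    have : j' = k + 1 ∨ j' = k + 2 := by omega
    rcases this with rfl | rfl
    · have hw := h.walk.restrict (k' := k + 1) (by omega) subset_rfl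
        fun j hj => h.walk.mem j (by omega)
      obtain ⟨a4, a5, -⟩ := hw.release h.shape (by omega) s1 s2 hq a3.symm
      obtain rfl : j + 1 = k := by omega
      exact h0 a5
    · obtain ⟨a4, a5, -⟩ := h.walk.release h.shape (by omega) s1 s2 hq a3.symm
      obtain rfl : j = k := by omega
      omega)
  refine ⟨H, fun hB => h.remove_two hi h1 h0 ?_⟩
  rw [e] at hB
  simpa only [mem_tail_two, not_or] using hB

/-- The last cell is removed if it is a leaf entered after a left turn. -/
lemma pop_leaf {k : ℕ} (h : State n v r Q (k + 2) b x i) (hi : i (k + 2) = 2)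
    (hl : b (k + 2) + -cw (x (k + 2)) ∉ Q) (hik : 1 ≤ i k)
    (hbk : b k = b (k + 2) + cw (x (k + 2)) + x (k + 2)) (hxk : cw^[i k] (x k) = -x (k + 2))
    (hs : Shape r (Q \ tail b (k + 1) (k + 2))) :
    State n v r (Q \ tail b (k + 1) (k + 2)) (k + 1) b x i ∧
      (Buildable n v (tiles (Q \ tail b (k + 1) (k + 2)) (Passed (k + 1) b x i)) →
        Buildable n v (tiles Q (Passed (k + 2) b x i))) := by
  have hx := h.walk.isDir (k + 2) le_rfl
  have hm := h.walk.mem (k + 2) le_rfl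
  obtain ⟨f1, f2, f3, f4, f5⟩ := h.corner_facts hi
  have f6 : b (k + 2) + -x (k + 2) + -cw (x (k + 2)) ∉ Q := fun hd =>
    hl (h.shape.diag hx.perp.neg_left.neg_right hm f2 hd)
  have hb := h.walk.b_add_x (Nat.lt_succ_self (k + 1))
  have g3 := h.walk.right_tile (Nat.lt_succ_self (k + 1))
  have hxk2 : cw (x (k + 1)) = -x (k + 2) := by
    rw [h.walk.cw_x_succ (show k < k + 2 by omega), hxk]
  have hxk1 : x (k + 1) = cw (x (k + 2)) := by
    have := congrArg cw hxk2
    rwa [cw_cw, cw_neg, neg_inj] at this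
  have g4 := h.walk.right_tile (show k < k + 2 by omega)
  rw [hxk2, hxk1, neg_neg] at g4
  set T := tiles Q (Passed (k + 2) b x i) with hT
  set T' := tiles (Q \ tail b (k + 1) (k + 2)) (Passed (k + 1) b x i) with hT'
  generalize hm_eq : b (k + 2) = m at *
  generalize hX : x (k + 2) = X at *
  have hp := hx.perp.neg_left
  have htail : ∀ c, c ∈ tail b (k + 1) (k + 2) ↔ c = m := by
    intro c
    rw [mem_tail_one, hm_eq]
  have hpa : Passed (k + 2) b x i (b k) (-X) := ⟨k, by omega, rfl, i k, hik, le_rfl, hxk.symm⟩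
  have hrel : ∀ j ≤ k + 1, ∀ s, 1 ≤ s → s ≤ i j → ∀ q, Perp (cw^[s] (x j)) q →
      b j + cw^[s] (x j) + q = m → j = k ∧ s = i k ∧ q = -cw X := by
    intro j hj s s1 s2 q hq hd
    obtain ⟨a1, a2, a3⟩ := h.walk.release h.shape (by omega) s1 s2 hq (by rw [hm_eq]; exact hd)
    obtain rfl : j = k := by omega
    subst a3
    refine ⟨rfl, rfl, ?_⟩
    rw [hxk, hbk] at hd
    have : q = m - (m + cw X + X + -X) := by nth_rewrite 1 [← hd]; abel
    rw [this]; abel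
  have hbkm : b k ≠ m := fun he => by
    have := h.walk.inj k (by omega) (k + 2) le_rfl (by rw [hm_eq]; exact he)
    omega
  -- Exactly one tile is released: the one of `b k` diagonal to the leaf.
  have e1 : T' = {t ∈ T | t.1 ≠ m} \ {(b k, -X + -cw X)} := by
    refine tiles_ext isCorner_of_mem_tiles (fun t ht => ht.1.1.2.1) fun c p q hpq => ?_
    rw [hT', mem_tiles_sdiff hpq fun hc => passed_restrict (by omega) hc]
    simp only [htail, Set.mem_sdiff, Set.mem_ofPred_eq, Set.mem_singleton_iff]
    refine and_congr_right fun ht => not_congr ?_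
    have hct : c ∉ tail b (k + 1) (k + 2) := by rw [htail]; exact ht.2
    have key : ∀ p q, Perp p q → c + p + q = m → Passed (k + 2) b x i c p →
        (c, p + q) = (b k, -X + -cw X) := by
      intro p q hpq hd hpa
      rw [← passed_restrict (by omega) hct] at hpa
      obtain ⟨j, hj, rfl, s, h1, h2, rfl⟩ := hpa
      obtain ⟨rfl, rfl, rfl⟩ := hrel j hj s h1 h2 q hpq hd
      rw [hxk]
    constructor
    · rintro ⟨hd, hpa | hpa⟩
      · exact key p q hpq hd hpa
      · rw [add_comm p q]
        exact key q p hpq.symm (by rwa [add_right_comm]) hpa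
    · intro he
      obtain ⟨rfl, he'⟩ := Prod.mk.inj he
      refine ⟨by rw [add_assoc, he', hbk]; abel, ?_⟩
      rcases hpq.add_inj hp.neg_right he' with ⟨rfl, rfl⟩ | ⟨rfl, rfl⟩
      exacts [Or.inl hpa, Or.inr hpa]
  have hsub : T' ⊆ T := by rw [e1]; exact fun t ht => ht.1.1
  have c1 := h.corridor (k + 2) le_rfl 1 le_rfl (by omega)
  rw [Function.iterate_one, hX, hm_eq] at c1
  have c2 := h.corridor (k + 2) le_rfl 2 (by omega) (by omega)
  rw [cw_iterate_two, hX, hm_eq] at c2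
  have w0 := c1 (-X) hx.perp.symm.neg_right f4
  have w1 := c2 (cw X) hp f3
  have w2 := c2 (-cw X) hp.neg_right f6
  have hq3 : m + cw X + X = b k := hbk.symm
  -- This spot beside the released tile becomes clear only when that tile and the leaf are both
  -- gone.
  have w3 : Hover n v T' (m + cw X, X + -cw X) := by
    refine (w0.mono hsub).step isCorner_of_mem_tiles hx.perp.neg_right ?_
      (h.room.dir hm hx.rot hx.perp.neg_right.isCorner) (fun h => f1 (hsub h).1)
      (fun h => f1 (hsub h).1) (fun h => f1 (hsub h).1) ?_ ?_
    · rw [add_comm X]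
      simpa using adj_flip' hx.perp.symm.neg_right.neg_left v (m + cw X)
    · rw [hq3, e1]; exact fun h => h.2 rfl
    · rw [add_neg_cancel_right, e1]; exact fun h => h.1.2 rfl
  refine ⟨h.restrict (by omega) hs ?_, fun hB => ?_⟩
  · intro j hj s s1 s2 q hq hd
    obtain ⟨rfl, rfl, rfl⟩ := hrel j hj s s1 s2 q hq ((htail _).1 hd)
    rw [hxk, neg_neg, hbk, add_neg_cancel_right]
    exact w3
  have hA : ∀ t ∈ {t ∈ T | t.1 ≠ m}, IsCorner t.2 := fun t ht => ht.1.2.1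
  -- Building order: the released tile of `b k`, then the tile of the leaf on the side away from `b
  -- k`, reached from the front, and finally the other tile of the leaf.
  have hB1 : Buildable n v {t ∈ T | t.1 ≠ m} := by
    rw [e1] at hB w3
    refine Buildable.of_diff hA hB (h.room.self (h.walk.mem k (by omega)) hp.neg_right.isCorner)
      w3 ?_ (r := (b k, X + -cw X)) ⟨by rwa [add_comm], hbkm⟩ ?_ ?_
    · rw [← hq3]; exact adj_out hx.perp.neg_right v (m + cw X)
    · simpa using hx.perp.neg_right.ne_flip.symm
    · simpa using adj_flip hp.neg_right v (b k)
  have hnr : (m, -X + -cw X) ∉ T := by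
    rw [hT, mem_tiles hp.neg_right]
    rintro ⟨-, h1 | h1⟩
    · exact f6 h1
    · have := h.passed_cell (s := 2) (by omega) (by omega)
      rw [cw_iterate_two, hX, hm_eq] at this
      exact h1.1 this
  have hpx : (m, X + -cw X) ∈ T := by
    rw [hT, mem_tiles hx.perp.neg_right]
    refine ⟨hm, Or.inr ?_⟩
    have := h.walk.not_passed_exit (j := k + 2) le_rfl
    rw [hi, hX, hm_eq] at this
    simp only [Nat.reduceAdd, cw_iterate_three] at this
    rw [Function.iterate_succ_apply', cw_iterate_three, cw_neg, cw_cw, neg_neg] at this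
    exact this.symm
  have e2 : {t ∈ T | t.1 ≠ m} = (T \ {(m, X + cw X)}) \ {(m, X + -cw X)} := by
    ext ⟨c, u⟩
    simp only [Set.mem_ofPred_eq, Set.mem_sdiff, Set.mem_singleton_iff, Prod.mk.injEq]
    constructor
    · rintro ⟨h1, h2⟩
      exact ⟨⟨h1, fun h => h2 h.1⟩, fun h => h2 h.1⟩
    · rintro ⟨⟨h1, h2⟩, h3⟩
      refine ⟨h1, ?_⟩
      rintro rfl
      rcases (isCorner_of_mem_tiles _ h1).cases_perp hx.perp with h | h | h | h <;>
        simp only at h <;> subst h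
      exacts [h2 ⟨rfl, rfl⟩, f5 h1, h3 ⟨rfl, rfl⟩, hnr h1]
  have H1 : Hover n v (T \ {(m, X + cw X)}) (m, -X + cw X) := by
    refine (w1.mono Set.sdiff_subset).step (fun t ht => isCorner_of_mem_tiles t ht.1) hp ?_
      (h.room.self hm hp.isCorner) (fun h => f5 h.1) (fun h => h.2 (by simp)) (fun h => hnr h.1)
      (fun h => f2 h.1.1) (fun h => f1 h.1.1)
    simpa using adj_out hp.neg_left v (m + -X)
  have H2 : Hover n v ((T \ {(m, X + cw X)}) \ {(m, X + -cw X)}) (m, -X + -cw X) := by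
    refine (w2.mono (Set.sdiff_subset.trans Set.sdiff_subset)).step
      (fun t ht => isCorner_of_mem_tiles t ht.1.1) hp.neg_right ?_
      (h.room.self hm hp.neg_right.isCorner) (fun h => hnr h.1.1) (fun h => h.2 (by simp))
      (fun h => f5 (by simpa using h.1.1)) (fun h => f2 h.1.1.1) (fun h => hl h.1.1.1)
    simpa using adj_out hp.neg_right.neg_left v (m + -X)
  rw [e2] at hB1
  refine Buildable.of_diff isCorner_of_mem_tiles ?_ (h.room.self hm hx.perp.isCorner) H1
    (by simpa using adj_flip hp v m) hpx (by simpa [add_comm] using hx.perp.symm.ne_flip)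
    (adj_flip' hx.perp v m)
  refine Buildable.of_diff (fun t ht => isCorner_of_mem_tiles t ht.1) hB1
    (h.room.self hm hx.perp.neg_right.isCorner) H2 (by simpa using adj_flip hp.neg_right v m)
    (r := (b (k + 1), -X + -cw X)) ⟨g3, ?_⟩ ?_ ?_
  · rw [← hb]; simp [hx.ne_zero]
  · rw [← hb]; simp [hx.ne_zero]
  · rw [← hb]
    exact adj_out hx.perp.neg_right v m

end State

/-! ### Loops, winding numbers and removable cells -/

/-- The exit direction of the `j`-th cell of a walk. -/
def exitDir (x : ℕ → ℤ × ℤ) (i : ℕ → ℕ) (j : ℕ) : ℤ × ℤ := cw^[i j + 1] (x j)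

/-- The cell `b (j + 1)` (in the second case also `b j`) can be removed when the walk arrives
there. -/
def Removable (Q : Finset (ℤ × ℤ)) (b x : ℕ → ℤ × ℤ) (i : ℕ → ℕ) (j : ℕ) : Prop :=
  i (j + 1) = 2 ∧ ((b (j + 1) + x (j + 1) + -cw (x (j + 1)) ∈ Q ∧ i j ≠ 0) ∨
    ∃ j', j = j' + 1 ∧ i j = 1 ∧ i j' ≠ 0 ∧ b (j + 1) + x (j + 1) + -cw (x (j + 1)) ∉ Q ∧
      Relation.ReflTransGen (fun a c => (c ∈ Q ∧ c ≠ b (j + 1) ∧ c ≠ b j) ∧ gridGraph.Adj a c)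
        (b j') (b (j + 1) + -cw (x (j + 1))))

/-- The signed number of crossings of a unit step with an upward ray starting at the lower left
corner of the cell `(X + 1, Y + 1)`. -/
def crossing (X Y : ℤ) (c y : ℤ × ℤ) : ℤ :=
  if Y < c.2 then
    if c.1 = X ∧ y = (1, 0) then 1 else if c.1 = X + 1 ∧ y = (-1, 0) then -1 else 0
  else 0

/-- Lengthening the ray by one row adds a single edge, and one of its two cells is `w`, which the
step avoids. -/
lemma crossing_horiz {X Y : ℤ} {z y w : ℤ × ℤ} (hy : IsDir y) (h1 : z ≠ w) (h2 : z + y ≠ w)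
    (hw : (X, Y) = w ∨ (X + 1, Y) = w) : crossing X Y z y = crossing X (Y + -1) z y := by
  obtain ⟨z1, z2⟩ := z
  obtain ⟨w1, w2⟩ := w
  simp only [Prod.mk.injEq, ne_eq] at hw h1
  unfold crossing
  rcases hy with rfl | rfl | rfl | rfl <;> simp at h2 ⊢ <;> split_ifs <;> omega

/-- The two rays bound a column of cells, so the difference counts entering and leaving it and
telescopes along a loop. Its bottom edge is not crossed because one of the cells there is `w`. -/
lemma crossing_vert {X Y : ℤ} {z y w : ℤ × ℤ} (hy : IsDir y) (h1 : z ≠ w) (h2 : z + y ≠ w)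
    (hw : (X, Y) = w ∨ (X, Y + 1) = w) : crossing (X + -1) Y z y - crossing X Y z y =
      (if (z + y).1 = X ∧ Y < (z + y).2 then 1 else 0) - if z.1 = X ∧ Y < z.2 then 1 else 0 := by
  obtain ⟨z1, z2⟩ := z
  obtain ⟨w1, w2⟩ := w
  simp only [Prod.mk.injEq, ne_eq] at hw h1
  unfold crossing
  rcases hy with rfl | rfl | rfl | rfl <;> simp at h2 ⊢ <;> split_ifs <;> omega

namespace Walk

variable {r : ℤ × ℤ} {Q : Finset (ℤ × ℤ)} {k l : ℕ} {b x : ℕ → ℤ × ℤ} {i : ℕ → ℕ}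

lemma isDir_exit (h : Walk r Q k b x i) {j : ℕ} (hj : j ≤ k) : IsDir (exitDir x i j) :=
  (h.isDir j hj).iterate _

lemma exit_ne (h : Walk r Q k b x i) {j : ℕ} (hj : j ≤ k) : exitDir x i j ≠ x j := by
  have hx := h.isDir j hj
  have := h.le_two j hj
  unfold exitDir
  have h3 : i j = 0 ∨ i j = 1 ∨ i j = 2 := by omega
  rcases h3 with h | h | h <;> rw [h]
  · exact hx.ne_cw.symm
  · simpa using hx.ne_neg.symm
  · simpa using hx.ne_neg_cw.symm

lemma b_succ' (h : Walk r Q k b x i) {j : ℕ} (hj : j < k) : b j + exitDir x i j = b (j + 1) :=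
  (h.b_succ j hj).symm

lemma exit_mem (h : Walk r Q k b x i) (hl : l ≤ k) (hloop : b k + exitDir x i k = b l) {j : ℕ}
    (hj : j ≤ k) : b j + exitDir x i j ∈ Q := by
  rcases hj.lt_or_eq with hj | rfl
  · rw [h.b_succ' hj]; exact h.mem _ hj
  · rw [hloop]; exact h.mem _ hl

lemma lt_of_loop (h : Walk r Q k b x i) (hl : l ≤ k) (hloop : b k + exitDir x i k = b l) :
    l + 1 < k := by
  by_contra hlt
  obtain rfl | rfl : l = k ∨ k = l + 1 := by omega
  · exact (h.isDir_exit le_rfl).ne_zero (by simpa using hloop)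
  · rw [← h.b_add_x (Nat.lt_succ_self l)] at hloop
    exact h.exit_ne le_rfl (add_left_cancel hloop)

/-- A loop does not pass an edge in both directions. -/
lemma no_reverse (h : Walk r Q k b x i) (hl : l ≤ k) (hloop : b k + exitDir x i k = b l)
    {j j' : ℕ} (hlj : l ≤ j) (hj : j ≤ k) (hlj' : l ≤ j') (hj' : j' ≤ k)
    (h1 : b j + exitDir x i j = b j') (h2 : b j' + exitDir x i j' = b j) : False := by
  have hlt := h.lt_of_loop hl hloop
  have succ : ∀ j j', j ≤ k → l ≤ j' → j' ≤ k → b j + exitDir x i j = b j' →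
      (j < k ∧ j' = j + 1) ∨ (j = k ∧ j' = l) := by
    intro j j' hj hlj' hj' h1
    rcases hj.lt_or_eq with hj | rfl
    · rw [h.b_succ' hj] at h1
      exact Or.inl ⟨hj, (h.inj _ hj _ hj' h1).symm⟩
    · rw [hloop] at h1
      exact Or.inr ⟨rfl, (h.inj _ hl _ hj' h1).symm⟩
  have a1 := succ j j' hj hlj' hj' h1
  have a2 := succ j' j hj' hlj hj h2
  omega

lemma sum_telescope (h : Walk r Q k b x i) (hl : l ≤ k) (hloop : b k + exitDir x i k = b l)
    (φ : ℤ × ℤ → ℤ) :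
    ∑ j ∈ Finset.Ico l (k + 1), (φ (b j + exitDir x i j) - φ (b j)) = 0 := by
  rw [Finset.sum_sub_distrib, Finset.sum_Ico_succ_top hl, hloop,
    Finset.sum_eq_sum_Ico_succ_bot (by omega : l < k + 1), ← Finset.sum_Ico_add' _ l k 1]
  rw [Finset.sum_congr rfl fun j hj => by rw [h.b_succ' (Finset.mem_Ico.1 hj).2]]
  ring

/-- The winding number of a loop around the corner `u` of the cell `c`. -/
def winding (k l : ℕ) (b x : ℕ → ℤ × ℤ) (i : ℕ → ℕ) (c u : ℤ × ℤ) : ℤ :=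
  ∑ j ∈ Finset.Ico l (k + 1),
    crossing (c.1 + (u.1 - 1) / 2) (c.2 + (u.2 - 1) / 2) (b j) (exitDir x i j)

/-- The base point slides along the side between `c` and the free cell `c + m`, which no step of the
loop crosses. -/
lemma winding_cross (h : Walk r Q k b x i) (hl : l ≤ k) (hloop : b k + exitDir x i k = b l)
    {c m : ℤ × ℤ} (hm : IsDir m) (hc : c + m ∉ Q) :
    winding k l b x i c (m + cw m) = winding k l b x i c (m + -cw m) := by
  have hne : ∀ j ∈ Finset.Ico l (k + 1), IsDir (exitDir x i j) ∧ b j ≠ c + m ∧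
      b j + exitDir x i j ≠ c + m := by
    intro j hj
    have hj' := Finset.mem_Ico.1 hj
    exact ⟨h.isDir_exit (by omega), fun he => hc (he ▸ h.mem j (by omega)),
      fun he => hc (he ▸ h.exit_mem hl hloop (by omega))⟩
  have horiz : ∀ X Y : ℤ, ((X, Y) = c + m ∨ (X + 1, Y) = c + m) →
      ∀ j ∈ Finset.Ico l (k + 1), crossing X Y (b j) (exitDir x i j) =
        crossing X (Y + -1) (b j) (exitDir x i j) := by
    intro X Y hXY j hj
    obtain ⟨h1, h2, h3⟩ := hne j hj
    exact crossing_horiz h1 h2 h3 hXY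
  have vert : ∀ X Y : ℤ, ((X, Y) = c + m ∨ (X, Y + 1) = c + m) →
      ∑ j ∈ Finset.Ico l (k + 1), crossing X Y (b j) (exitDir x i j) =
      ∑ j ∈ Finset.Ico l (k + 1), crossing (X + -1) Y (b j) (exitDir x i j) := by
    intro X Y hXY
    rw [eq_comm, ← sub_eq_zero, ← Finset.sum_sub_distrib,
      ← h.sum_telescope hl hloop (fun z => if z.1 = X ∧ Y < z.2 then 1 else 0)]
    refine Finset.sum_congr rfl fun j hj => ?_
    obtain ⟨h1, h2, h3⟩ := hne j hj
    exact crossing_vert h1 h2 h3 hXY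
  obtain ⟨c1, c2⟩ := c
  unfold winding
  rcases hm with rfl | rfl | rfl | rfl
  · simpa [cw] using (Finset.sum_congr rfl (horiz c1 c2 (by simp))).symm
  · simpa [cw] using Finset.sum_congr rfl (horiz (c1 + -1) c2 (by simp))
  · simpa [cw] using vert c1 c2 (by simp)
  · simpa [cw] using (vert c1 (c2 + -1) (by simp)).symm

/-- The winding number vanishes on the left side of the walk. -/
lemma winding_left (h : Walk r Q k b x i) (hs : Shape r Q) (hl : l ≤ k)
    (hloop : b k + exitDir x i k = b l) {j : ℕ} (hj : j ≤ k) {s : ℕ} (hsi : s ≤ i j) :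
    winding k l b x i (b j) (cw^[s] (x j) + cw^[s + 1] (x j)) = 0 := by
  have step : ∀ j ≤ k, winding k l b x i (b j) (x j + cw (x j)) = 0 →
      ∀ s ≤ i j, winding k l b x i (b j) (cw^[s] (x j) + cw^[s + 1] (x j)) = 0 := by
    intro j hj h0 s
    induction s with
    | zero => intro _; simpa using h0
    | succ s ih =>
      intro hsi
      have := h.winding_cross hl hloop ((h.isDir j hj).iterate (s + 1))
        (h.free j hj (s + 1) (by omega) hsi)
      rw [Function.iterate_succ_apply' cw (s + 1), this, ← ih (by omega),
        Function.iterate_succ_apply', cw_cw, neg_neg, add_comm]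
  refine step j hj ?_ s hsi
  clear hsi
  induction j with
  | zero =>
    -- The first corner is the upper left one of the root, and its upward ray meets no cell of the
    -- shape.
    rw [h.x_zero, h.b_zero]
    refine Finset.sum_eq_zero fun j hj => ?_
    have hj' := Finset.mem_Ico.1 hj
    have := hs.top _ (h.mem j (by omega))
    unfold crossing
    rw [if_neg]
    simpa [cw] using this
  | succ j ih =>
    have := step j (by omega) (ih (by omega)) (i j) le_rfl
    rw [← this, h.cw_x_succ (by omega), h.x_succ j (by omega), h.b_succ j (by omega)]
    unfold winding
    refine Finset.sum_congr rfl fun j' hj' => ?_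
    congr 1 <;> simp <;> omega

lemma winding_exit (h : Walk r Q k b x i) (hs : Shape r Q) (hl : l ≤ k)
    (hloop : b k + exitDir x i k = b l) {j : ℕ} (hj : j ≤ k) :
    winding k l b x i (b j) (exitDir x i j + -cw (exitDir x i j)) = 0 := by
  rw [← h.winding_left hs hl hloop hj le_rfl]
  congr 1
  unfold exitDir
  rw [Function.iterate_succ_apply' cw (i j), cw_cw, neg_neg, add_comm]

/-- In its top row a loop runs to the right. -/
lemma top_step (h : Walk r Q k b x i) (hs : Shape r Q) (hl : l ≤ k)
    (hloop : b k + exitDir x i k = b l) {j : ℕ} (hlj : l ≤ j) (hj : j ≤ k)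
    (hy : exitDir x i j = (-1, 0)) (hmax : ∀ j', l ≤ j' → j' ≤ k → (b j').2 ≤ (b j).2) :
    False := by
  have hw := h.winding_exit hs hl hloop hj
  rw [hy] at hw
  simp only [winding, cw, neg_zero, Prod.neg_mk, neg_neg, Prod.mk_add_mk] at hw
  norm_num at hw
  -- The ray meets the loop only in one edge of the top row; a term of the wrong sign would traverse
  -- that edge in reverse.
  have hle : ∀ j' ∈ Finset.Ico l (k + 1),
      0 ≤ -crossing ((b j).1 + -1) ((b j).2 + -1) (b j') (exitDir x i j') := by
    intro j' hj'
    rw [Finset.mem_Ico] at hj'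
    have hm := hmax j' hj'.1 (by omega)
    unfold crossing
    split_ifs with h1 h2 h3
    · exfalso
      have e : b j' = b j + exitDir x i j := by
        rw [hy]; ext
        · simpa using h2.1
        · simp; omega
      refine h.no_reverse hl hloop hlj hj hj'.1 (by omega) e.symm ?_
      rw [e, hy, h2.2, add_assoc]; simp
    all_goals norm_num
  have := Finset.single_le_sum hle (Finset.mem_Ico.2 ⟨hlj, Nat.lt_succ_of_le hj⟩)
  rw [Finset.sum_neg_distrib, hw, hy] at this
  simp [crossing] at this

/-- In its bottom row a loop runs to the left. -/
lemma bottom_step (h : Walk r Q k b x i) (hs : Shape r Q) (hl : l ≤ k)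
    (hloop : b k + exitDir x i k = b l) {j : ℕ} (hlj : l ≤ j) (hj : j ≤ k)
    (hy : exitDir x i j = (1, 0)) (hmin : ∀ j', l ≤ j' → j' ≤ k → (b j).2 ≤ (b j').2) :
    False := by
  have hw := h.winding_exit hs hl hloop hj
  rw [hy] at hw
  simp only [winding, cw, neg_zero, Prod.neg_mk, neg_neg, Prod.mk_add_mk] at hw
  norm_num at hw
  -- A ray from below the bottom row sees every crossing of a vertical line by the loop, and these
  -- cancel.
  have hw2 : ∑ j' ∈ Finset.Ico l (k + 1),
      crossing (b j).1 ((b j).2 - 1) (b j') (exitDir x i j') = 0 := by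
    rw [← h.sum_telescope hl hloop (fun z => if (b j).1 < z.1 then 1 else 0)]
    refine Finset.sum_congr rfl fun j' hj' => ?_
    rw [Finset.mem_Ico] at hj'
    have hm := hmin j' hj'.1 (by omega)
    have hd := h.isDir_exit (j := j') (by omega)
    unfold crossing
    generalize b j' = z at *
    generalize exitDir x i j' = y at *
    rw [if_pos (by omega)]
    obtain ⟨z1, z2⟩ := z
    rcases hd with rfl | rfl | rfl | rfl <;> simp <;> split_ifs <;> simp_all <;> omega
  -- The two rays differ by one edge of the bottom row, which is not traversed in reverse.
  have hle : ∀ j' ∈ Finset.Ico l (k + 1),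
      0 ≤ crossing (b j).1 ((b j).2 - 1) (b j') (exitDir x i j') -
        crossing (b j).1 (b j).2 (b j') (exitDir x i j') := by
    intro j' hj'
    rw [Finset.mem_Ico] at hj'
    have hm := hmin j' hj'.1 (by omega)
    unfold crossing
    rw [if_pos (by omega)]
    by_cases h0 : (b j).2 < (b j').2
    · rw [if_pos h0]; simp
    rw [if_neg h0]
    split_ifs with h2 h3
    · norm_num
    · exfalso
      have e : b j' = b j + exitDir x i j := by
        rw [hy]; ext
        · simpa using h3.1
        · simp; omega
      refine h.no_reverse hl hloop hlj hj hj'.1 (by omega) e.symm ?_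
      rw [e, hy, h3.2, add_assoc]; simp
    · norm_num
  have := Finset.single_le_sum hle (Finset.mem_Ico.2 ⟨hlj, Nat.lt_succ_of_le hj⟩)
  rw [Finset.sum_sub_distrib, hw, hw2, hy] at this
  simp [crossing] at this

lemma path_down (h : Walk r Q k b x i) {p q : ℤ × ℤ} {s e : ℕ} (hse : s ≤ e) (hek : e ≤ k)
    (hp : ∀ j, s ≤ j → j < e → b j ≠ p ∧ b j ≠ q) :
    Relation.ReflTransGen (fun a c => (c ∈ Q ∧ c ≠ p ∧ c ≠ q) ∧ gridGraph.Adj a c)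
      (b e) (b s) := by
  induction e, hse using Nat.le_induction with
  | base => exact .refl
  | succ e hse ih =>
    refine Relation.ReflTransGen.head ⟨⟨h.mem e (by omega), hp e hse (by omega)⟩, ?_⟩
      (ih (by omega) fun j h1 h2 => hp j h1 (by omega))
    rw [← h.b_add_x (show e < k by omega)]
    exact gridGraph_adj_add (h.isDir _ hek)

lemma turn_of_straight (h : Walk r Q k b x i) {j : ℕ} (hj : j ≤ k)
    (he : exitDir x i j = -x j) : i j = 1 := by
  have hx := h.isDir j hj
  have := h.le_two j hj
  unfold exitDir at he
  have h3 : i j = 0 ∨ i j = 1 ∨ i j = 2 := by omega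
  rcases h3 with h | h | h <;> rw [h] at he
  · exact absurd (by rw [show cw (x j) = -x j from he, neg_neg]) hx.ne_neg_cw
  · exact h
  · simp only [Nat.reduceAdd, cw_iterate_three, neg_inj] at he
    exact absurd he.symm hx.ne_cw

lemma turn_of_right (h : Walk r Q k b x i) {j : ℕ} (hj : j ≤ k)
    (he : exitDir x i j = -cw (x j)) : i j = 2 := by
  have hx := h.isDir j hj
  have := h.le_two j hj
  unfold exitDir at he
  have h3 : i j = 0 ∨ i j = 1 ∨ i j = 2 := by omega
  rcases h3 with h | h | h <;> rw [h] at he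
  · exact absurd he hx.rot.ne_neg
  · simp only [Nat.reduceAdd, cw_iterate_two, neg_inj] at he
    exact absurd he hx.ne_cw
  · exact h

/-- A loop has a removable cell in the extreme row on the side `d`, if that row is passed to the
right only and does not contain the first cell of the loop. -/
lemma exists_removable (h : Walk r Q k b x i) (hl : l ≤ k) (hloop : b k + exitDir x i k = b l)
    {d : ℤ × ℤ} (hd : IsDir d) {H : ℤ × ℤ → ℤ} (H_add : ∀ z w, H (z + w) = H z + H w)
    (H_d : H d = 1) (H_cw : H (cw d) = 0)
    (hno : ∀ j, l ≤ j → j ≤ k → exitDir x i j = -cw d →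
      (∀ j', l ≤ j' → j' ≤ k → H (b j') ≤ H (b j)) → False)
    {t : ℕ} (hlt : l ≤ t) (ht : t ≤ k) (htl : H (b l) < H (b t)) :
    ∃ j < k, Removable Q b x i j := by
  classical
  have hdir : ∀ y, IsDir y → y = d ∨ y = -d ∨ y = cw d ∨ y = -cw d := by
    intro y hy
    rcases hd with rfl | rfl | rfl | rfl <;> rcases hy with rfl | rfl | rfl | rfl <;> simp [cw]
  have H_neg : ∀ z, H (-z) = -H z := by
    intro z
    have h0 := H_add 0 0
    have h1 := H_add z (-z)
    rw [add_neg_cancel] at h1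
    rw [add_zero] at h0
    omega
  obtain ⟨m, hm, hmax⟩ := Finset.exists_max_image (Finset.Icc l k) (fun j => H (b j))
    ⟨l, Finset.mem_Icc.2 ⟨le_rfl, hl⟩⟩
  rw [Finset.mem_Icc] at hm
  have hmax' : ∀ j, l ≤ j → j ≤ k → H (b j) ≤ H (b m) := fun j h1 h2 =>
    hmax j (Finset.mem_Icc.2 ⟨h1, h2⟩)
  have hlm : H (b l) < H (b m) := htl.trans_le (hmax' t hlt ht)
  -- At the last index `J` in the extreme row the loop leaves this row by a right turn.
  obtain ⟨J, hJ, hJmax⟩ := Finset.exists_max_image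
    ((Finset.Icc l k).filter fun j => H (b j) = H (b m)) (fun j => j)
    ⟨m, Finset.mem_filter.2 ⟨Finset.mem_Icc.2 hm, rfl⟩⟩
  obtain ⟨hJ, hJM⟩ := Finset.mem_filter.1 hJ
  rw [Finset.mem_Icc] at hJ
  -- A cell of the extreme row is entered along the row in the permitted direction or from the inner
  -- side, so never followed by a left turn there.
  have entry : ∀ j, l ≤ j → j < k → H (b (j + 1)) = H (b m) →
      x (j + 1) = -cw d ∨ x (j + 1) = -d := by
    intro j h1 h2 h3
    have hb := h.b_add_x h2
    have hj := hmax' j h1 h2.le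
    rw [← hb, H_add, h3] at hj
    rcases hdir _ (h.isDir (j + 1) h2) with hx | hx | hx | hx
    · rw [hx, H_d] at hj; omega
    · exact Or.inr hx
    · exfalso
      refine hno j h1 h2.le ?_ ?_
      · rw [← hx, h.x_succ j h2, neg_neg]; rfl
      · intro j' h1' h2'
        rw [← hb, H_add, h3, hx, H_cw, add_zero]
        exact hmax' j' h1' h2'
    · exact Or.inl hx
  have hJl : l ≠ J := by rintro rfl; omega
  obtain ⟨j, rfl⟩ : ∃ j, J = j + 1 := ⟨J - 1, by omega⟩
  have hyJ : exitDir x i (j + 1) = -d := by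
    have hlt : H (b (j + 1) + exitDir x i (j + 1)) < H (b m) := by
      rcases hJ.2.lt_or_eq with h1 | h1
      · rw [h.b_succ' h1]
        refine lt_of_le_of_ne (hmax' _ (by omega) h1) fun he => ?_
        have := hJmax (j + 2) (Finset.mem_filter.2 ⟨Finset.mem_Icc.2 ⟨by omega, h1⟩, he⟩)
        omega
      · rw [h1, hloop]; exact hlm
    rw [H_add, hJM] at hlt
    rcases hdir _ (h.isDir_exit hJ.2) with hx | hx | hx | hx
    · rw [hx, H_d] at hlt; omega
    · exact hx
    · rw [hx, H_cw] at hlt; omega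
    · rw [hx, H_neg, H_cw] at hlt; omega
  have hjk : j < k := by omega
  have hxJ : x (j + 1) = -cw d := by
    refine (entry j (by omega) hjk hJM).resolve_right fun hx => h.exit_ne hJ.2 ?_
    rw [hyJ, hx]
  refine ⟨j, hjk, h.turn_of_right hJ.2 (by rw [hxJ, cw_neg, cw_cw, neg_neg, hyJ]), ?_⟩
  have hyj : exitDir x i j = cw d := by
    have := h.x_succ j hjk
    rw [hxJ, neg_inj] at this
    exact this.symm
  have hbj : b (j + 1) + x (j + 1) = b j := h.b_add_x hjk
  have hHj : H (b j) = H (b m) := by rw [← hbj, H_add, hJM, hxJ, H_neg, H_cw]; simp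
  have hjl : l ≠ j := by rintro rfl; omega
  obtain ⟨j', rfl⟩ : ∃ j', j = j' + 1 := ⟨j - 1, by omega⟩
  rw [hbj, hxJ, cw_neg, cw_cw, neg_neg]
  have hbj' : b (j' + 1) + x (j' + 1) = b j' := h.b_add_x (by omega)
  rcases entry j' (by omega) (by omega) hHj with hx | hx
  · have h1 : i (j' + 1) = 1 := h.turn_of_straight hjk.le (by rw [hx, neg_neg, hyj])
    by_cases hQ : b (j' + 1) + -d ∈ Q
    · exact Or.inl ⟨hQ, by omega⟩
    have hyj' : exitDir x i j' = cw d := by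
      have := h.x_succ j' (by omega)
      rw [hx, neg_inj] at this
      exact this.symm
    have hHj' : H (b j') = H (b m) := by rw [← hbj', H_add, hHj, hx, H_neg, H_cw]; simp
    have hjl' : l ≠ j' := by rintro rfl; omega
    refine Or.inr ⟨j', rfl, h1, ?_, hQ, ?_⟩
    · obtain ⟨e, rfl⟩ : ∃ e, j' = e + 1 := ⟨j' - 1, by omega⟩
      rcases entry e (by omega) (by omega) hHj' with hx' | hx'
      · have := h.turn_of_straight (j := e + 1) (by omega) (by rw [hx', neg_neg, hyj'])
        omega
      · have := h.turn_of_right (j := e + 1) (by omega) (by rw [hx', cw_neg, neg_neg, hyj'])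
        omega
    -- The rest of the loop, run backwards, is the detour around the two cells.
    · have hinj : ∀ e ≤ k, e ≠ j' + 1 + 1 → e ≠ j' + 1 →
          b e ≠ b (j' + 1 + 1) ∧ b e ≠ b (j' + 1) := fun e he h1 h2 =>
        ⟨fun hh => h1 (h.inj _ he _ hJ.2 hh), fun hh => h2 (h.inj _ he _ (by omega) hh)⟩
      refine (h.path_down (s := l) (e := j') (by omega) (by omega) fun e h1 h2 =>
        hinj e (by omega) (by omega) (by omega)).trans ?_
      rw [← hyJ]
      rcases hJ.2.lt_or_eq with h2 | h2
      · rw [h.b_succ' h2]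
        refine Relation.ReflTransGen.head
          ⟨⟨h.mem k le_rfl, hinj k le_rfl (by omega) (by omega)⟩, ?_⟩
          (h.path_down h2 le_rfl fun e h1 h2 => hinj e (by omega) (by omega) (by omega))
        rw [← hloop]
        exact (gridGraph_adj_add (h.isDir_exit le_rfl)).symm
      · rw [h2, hloop]
  · refine Or.inl ⟨?_, ?_⟩
    · rw [← hx, hbj']; exact h.mem _ (by omega)
    · have := h.turn_of_right hjk.le (by rw [hx, cw_neg, neg_neg, hyj])
      omega

/-- If no cell is removable, then the walk does not return to a former cell. -/
lemma no_loop (h : Walk r Q k b x i) (hs : Shape r Q) (hl : l ≤ k)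
    (hloop : b k + cw^[i k + 1] (x k) = b l) (hnr : ∀ j < k, ¬ Removable Q b x i j) : False := by
  have hloop : b k + exitDir x i k = b l := hloop
  have hlt := h.lt_of_loop hl hloop
  have top : ∀ t, l ≤ t → t ≤ k → (b t).2 ≤ (b l).2 := by
    intro t h1 h2
    by_contra hh
    obtain ⟨j, h3, h4⟩ := h.exists_removable hl hloop (d := (0, 1)) (H := fun z => z.2)
      (by simp [IsDir]) (fun _ _ => rfl) rfl (by simp [cw])
      (fun j h1 h2 h3 h4 => h.top_step hs hl hloop h1 h2 (by simpa [cw] using h3) h4) h1 h2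
      (not_le.1 hh)
    exact hnr j h3 h4
  have bottom : ∀ t, l ≤ t → t ≤ k → (b l).2 ≤ (b t).2 := by
    intro t h1 h2
    by_contra hh
    obtain ⟨j, h3, h4⟩ := h.exists_removable hl hloop (d := (0, -1)) (H := fun z => -z.2)
      (by simp [IsDir]) (fun z w => by simp; ring) (by simp) (by simp [cw])
      (fun j h1 h2 h3 h4 => h.bottom_step hs hl hloop h1 h2 (by simpa [cw] using h3)
        fun j' a1 a2 => by simpa using h4 j' a1 a2) h1 h2
      (by simpa using hh)
    exact hnr j h3 h4
  -- The loop is now confined to one row, where both horizontal directions are excluded.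
  have e := h.b_succ' (show l < k by omega)
  have h1 := top (l + 1) (by omega) (by omega)
  have h2 := bottom (l + 1) (by omega) (by omega)
  rw [← e] at h1 h2
  rcases h.isDir_exit hl with hy | hy | hy | hy
  · exact h.bottom_step hs hl hloop le_rfl hl hy bottom
  · exact h.top_step hs hl hloop le_rfl hl hy top
  · rw [hy] at h1; simp at h1
  · rw [hy] at h2; simp at h2

end Walk

/-! ### Shapes after the removal of cells -/

lemma IsDir.eq_or {d y : ℤ × ℤ} (hd : IsDir d) (hy : IsDir y) :
    y = d ∨ y = -d ∨ y = cw d ∨ y = -cw d := by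
  rcases hd with rfl | rfl | rfl | rfl <;> rcases hy with rfl | rfl | rfl | rfl <;> simp [cw]

lemma gridGraph_adj_cases {c z d : ℤ × ℤ} (hd : IsDir d) (h : gridGraph.Adj c z) :
    z = c + d ∨ z = c + -d ∨ z = c + cw d ∨ z = c + -cw d := by
  rw [gridGraph_adj_iff] at h
  have e : z = c + (z - c) := by abel
  rcases hd.eq_or h with h1 | h1 | h1 | h1 <;> rw [h1] at e <;> simp [← e]

lemma not_shareCorner_self (c : ℤ × ℤ) : ¬ ShareCorner c c := by simp [ShareCorner]

/-- In the larger set the inner diagonal cell may be present, which turns the second alternative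
into the first. Contrapositively, removing cells creates no removable cell on the walk. -/
lemma Removable.mono {Q Z : Finset (ℤ × ℤ)} {b x : ℕ → ℤ × ℤ} {i : ℕ → ℕ} {j : ℕ}
    (h : Removable (Q \ Z) b x i j) : Removable Q b x i j := by
  refine ⟨h.1, ?_⟩
  rcases h.2 with ⟨h1, h2⟩ | ⟨j', h1, h2, h3, h4, h5⟩
  · exact Or.inl ⟨(Finset.mem_sdiff.1 h1).1, h2⟩
  · by_cases hd : b (j + 1) + x (j + 1) + -cw (x (j + 1)) ∈ Q
    · exact Or.inl ⟨hd, by omega⟩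
    · exact Or.inr ⟨j', h1, h2, h3, hd, Relation.ReflTransGen.mono
        (fun a c hac => ⟨⟨(Finset.mem_sdiff.1 hac.1.1).1, hac.1.2⟩, hac.2⟩) _ _ h5⟩

namespace Walk

variable {r : ℤ × ℤ} {Q : Finset (ℤ × ℤ)} {k : ℕ} {b x : ℕ → ℤ × ℤ} {i : ℕ → ℕ}

lemma ne_root (h : Walk r Q k b x i) {j : ℕ} (hj : j ≤ k) (h0 : j ≠ 0) : r ≠ b j := by
  rw [← h.b_zero]
  exact fun he => h0 (h.inj 0 (by omega) j hj he).symm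

lemma shape_leaf (h : Walk r Q (k + 1) b x i) (hs : Shape r Q) (hi : i (k + 1) = 2)
    (hl : b (k + 1) + -cw (x (k + 1)) ∉ Q) : Shape r (Q \ tail b k (k + 1)) := by
  have nbr : ∀ z ∈ tail b k (k + 1), ∀ w ∈ Q \ tail b k (k + 1), gridGraph.Adj z w → w = b k := by
    intro z hz w hw hadj
    rw [mem_tail_one] at hz
    subst hz
    have hwQ := (Finset.mem_sdiff.1 hw).1
    have f1 := h.free (k + 1) le_rfl 1 le_rfl (by omega)
    have f2 := h.free (k + 1) le_rfl 2 (by omega) (by omega)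
    rw [Function.iterate_one] at f1
    rw [cw_iterate_two] at f2
    rcases gridGraph_adj_cases (h.isDir (k + 1) le_rfl) hadj with rfl | rfl | rfl | rfl
    · exact h.b_add_x (Nat.lt_succ_self k)
    · exact absurd hwQ f2
    · exact absurd hwQ f1
    · exact absurd hwQ hl
  refine hs.remove (by rw [mem_tail_one]; exact h.ne_root le_rfl (by omega)) ?_ ?_
  · rintro u hu w hw ⟨z, hz, h1⟩ ⟨z', hz', h2⟩
    rw [nbr z hz u hu h1.symm, nbr z' hz' w hw h2.symm]
  · intro z hz t₁ h₁ t₂ h₂ hsh a1 a2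
    rw [nbr z hz t₁ h₁ a1, nbr z hz t₂ h₂ a2] at hsh
    exact absurd hsh (not_shareCorner_self _)

/-- The cell `d` completing the 2 × 2 block at the turn is adjacent to every remaining neighbour of
the corner cell and replaces it in paths and as a common neighbour. -/
lemma shape_corner (h : Walk r Q (k + 1) b x i) (hs : Shape r Q) (hi : i (k + 1) = 2)
    (hd : b (k + 1) + x (k + 1) + -cw (x (k + 1)) ∈ Q) :
    Shape r (Q \ tail b k (k + 1)) := by
  have hx := h.isDir (k + 1) le_rfl
  have hb := h.b_add_x (Nat.lt_succ_self k)
  set d := b (k + 1) + x (k + 1) + -cw (x (k + 1)) with hd_eq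
  have hdZ : d ∈ Q \ tail b k (k + 1) := by
    refine Finset.mem_sdiff.2 ⟨hd, ?_⟩
    rw [mem_tail_one, hd_eq, add_assoc]
    intro he
    exact hx.ne_cw (by simpa [add_neg_eq_zero] using he)
  have hda : gridGraph.Adj d (b k) := by
    rw [hd_eq, hb]; exact (gridGraph_adj_add hx.rot.neg).symm
  have hdb : gridGraph.Adj d (b (k + 1) + -cw (x (k + 1))) := by
    rw [hd_eq, add_right_comm]; exact (gridGraph_adj_add hx).symm
  have nbr : ∀ z ∈ tail b k (k + 1), ∀ w ∈ Q \ tail b k (k + 1), gridGraph.Adj z w →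
      gridGraph.Adj d w := by
    intro z hz w hw hadj
    rw [mem_tail_one] at hz
    subst hz
    have hwQ := (Finset.mem_sdiff.1 hw).1
    have f1 := h.free (k + 1) le_rfl 1 le_rfl (by omega)
    have f2 := h.free (k + 1) le_rfl 2 (by omega) (by omega)
    rw [Function.iterate_one] at f1
    rw [cw_iterate_two] at f2
    rcases gridGraph_adj_cases hx hadj with rfl | rfl | rfl | rfl
    · rw [hb]; exact hda
    · exact absurd hwQ f2
    · exact absurd hwQ f1
    · exact hdb
  refine hs.remove (by rw [mem_tail_one]; exact h.ne_root le_rfl (by omega)) ?_ ?_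
  · rintro u hu w hw ⟨z, hz, h1⟩ ⟨z', hz', h2⟩
    exact (Relation.ReflTransGen.single ⟨hdZ, (nbr z hz u hu h1.symm).symm⟩).tail
      ⟨hw, nbr z' hz' w hw h2.symm⟩
  · intro z hz t₁ h₁ t₂ h₂ hsh a1 a2
    exact ⟨d, hdZ, nbr z hz t₁ h₁ a1, nbr z hz t₂ h₂ a2⟩

/-- Without the corner cell alone, `b (k + 1)` and the cell after the turn would touch in a point
with no common neighbour. With both cells gone, each had at most one remaining neighbour, and
`hpath` joins these. -/
lemma shape_two (h : Walk r Q (k + 2) b x i) (hs : Shape r Q) (hi : i (k + 2) = 2)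
    (h1 : i (k + 1) = 1) (hd : b (k + 2) + x (k + 2) + -cw (x (k + 2)) ∉ Q)
    (hpath : Relation.ReflTransGen
      (fun a c => (c ∈ Q ∧ c ≠ b (k + 2) ∧ c ≠ b (k + 1)) ∧ gridGraph.Adj a c)
        (b k) (b (k + 2) + -cw (x (k + 2)))) :
    Shape r (Q \ tail b k (k + 2)) := by
  have hx := h.isDir (k + 2) le_rfl
  have hb2 := h.b_add_x (show k + 1 < k + 2 by omega)
  have hb1 := h.b_add_x (show k < k + 2 by omega)
  have hx1 := h.x_succ (k + 1) (by omega)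
  rw [h1, cw_iterate_two, neg_neg] at hx1
  rw [← hx1] at hb1
  have hmem : ∀ c, c ∈ Q \ tail b k (k + 2) ↔ c ∈ Q ∧ c ≠ b (k + 2) ∧ c ≠ b (k + 1) := by
    intro c
    rw [Finset.mem_sdiff, mem_tail_two, not_or]
  have nbr2 : ∀ w ∈ Q \ tail b k (k + 2), gridGraph.Adj (b (k + 2)) w →
      w = b (k + 2) + -cw (x (k + 2)) := by
    intro w hw hadj
    rw [hmem] at hw
    have f1 := h.free (k + 2) le_rfl 1 le_rfl (by omega)
    have f2 := h.free (k + 2) le_rfl 2 (by omega) (by omega)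
    rw [Function.iterate_one] at f1
    rw [cw_iterate_two] at f2
    rcases gridGraph_adj_cases hx hadj with rfl | rfl | rfl | rfl
    · exact absurd hb2 hw.2.2
    · exact absurd hw.1 f2
    · exact absurd hw.1 f1
    · rfl
  have nbr1 : ∀ w ∈ Q \ tail b k (k + 2), gridGraph.Adj (b (k + 1)) w → w = b k := by
    intro w hw hadj
    rw [hmem] at hw
    have f1 := h.free (k + 1) (by omega) 1 le_rfl h1.ge
    rw [Function.iterate_one, ← hx1] at f1
    rcases gridGraph_adj_cases hx hadj with rfl | rfl | rfl | rfl
    · exact hb1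
    · rw [← hb2, add_neg_cancel_right] at hw
      exact absurd rfl hw.2.1
    · exact absurd hw.1 f1
    · rw [hb2] at hd
      exact absurd hw.1 hd
  have hpath' : Relation.ReflTransGen (fun a c => c ∈ Q \ tail b k (k + 2) ∧ gridGraph.Adj a c)
      (b k) (b (k + 2) + -cw (x (k + 2))) :=
    Relation.ReflTransGen.mono (fun a c hac => ⟨(hmem c).2 hac.1, hac.2⟩) _ _ hpath
  have hbk : b k ∈ Q \ tail b k (k + 2) := by
    rw [hmem]
    refine ⟨h.mem k (by omega), fun he => ?_, fun he => ?_⟩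
    · have := h.inj k (by omega) _ le_rfl he; omega
    · have := h.inj k (by omega) (k + 1) (by omega) he; omega
  have hrev : ∀ w, Relation.ReflTransGen
      (fun a c => c ∈ Q \ tail b k (k + 2) ∧ gridGraph.Adj a c) (b k) w →
      w ∈ Q \ tail b k (k + 2) ∧ Relation.ReflTransGen
        (fun a c => c ∈ Q \ tail b k (k + 2) ∧ gridGraph.Adj a c) w (b k) := by
    intro w hw
    induction hw with
    | refl => exact ⟨hbk, .refl⟩
    | tail _ hbc ih => exact ⟨hbc.1, ih.2.head ⟨ih.1, hbc.2.symm⟩⟩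
  refine hs.remove ?_ ?_ ?_
  · rw [mem_tail_two, not_or]
    exact ⟨h.ne_root le_rfl (by omega), h.ne_root (by omega) (by omega)⟩
  · have key : ∀ u ∈ Q \ tail b k (k + 2), (∃ z ∈ tail b k (k + 2), gridGraph.Adj u z) →
        u = b k ∨ u = b (k + 2) + -cw (x (k + 2)) := by
      rintro u hu ⟨z, hz, hadj⟩
      rcases mem_tail_two.1 hz with rfl | rfl
      · exact Or.inr (nbr2 u hu hadj.symm)
      · exact Or.inl (nbr1 u hu hadj.symm)
    intro u hu w hw h1 h2
    rcases key u hu h1 with rfl | rfl <;> rcases key w hw h2 with rfl | rfl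
    exacts [.refl, hpath', (hrev _ hpath').2, .refl]
  · intro z hz t₁ h₁ t₂ h₂ hsh a1 a2
    exfalso
    rcases mem_tail_two.1 hz with rfl | rfl
    · rw [nbr2 t₁ h₁ a1, nbr2 t₂ h₂ a2] at hsh
      exact not_shareCorner_self _ hsh
    · rw [nbr1 t₁ h₁ a1, nbr1 t₂ h₂ a2] at hsh
      exact not_shareCorner_self _ hsh

end Walk

/-! ### The induction on the disassembly -/

namespace State

variable {n : ℕ} {v r : ℤ × ℤ} {Q : Finset (ℤ × ℤ)} {k : ℕ} {b x : ℕ → ℤ × ℤ} {i : ℕ → ℕ}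

/-- The walk enters a new cell. -/
lemma push (h : State n v r Q k b x i) {c y : ℤ × ℤ} (hy : y = cw^[i k + 1] (x k))
    (hc : c = b k + y) (hcQ : c ∈ Q) (hnew : ∀ l ≤ k, c ≠ b l) :
    State n v r Q (k + 1) (Function.update b (k + 1) c) (Function.update x (k + 1) (-y))
      (Function.update i (k + 1) 0) ∧
    tiles Q (Passed (k + 1) (Function.update b (k + 1) c) (Function.update x (k + 1) (-y))
      (Function.update i (k + 1) 0)) = tiles Q (Passed k b x i) := by
  have ub : ∀ j ≤ k, Function.update b (k + 1) c j = b j := fun j hj =>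
    Function.update_of_ne (by omega) _ _
  have ux : ∀ j ≤ k, Function.update x (k + 1) (-y) j = x j := fun j hj =>
    Function.update_of_ne (by omega) _ _
  have ui : ∀ j ≤ k, Function.update i (k + 1) 0 j = i j := fun j hj =>
    Function.update_of_ne (by omega) _ _
  have us : ∀ j, j ≤ k + 1 → j ≤ k ∨ j = k + 1 := fun j hj => by omega
  have e : Passed (k + 1) (Function.update b (k + 1) c) (Function.update x (k + 1) (-y))
      (Function.update i (k + 1) 0) = Passed k b x i := by
    ext c' d
    constructor
    · rintro ⟨j, hj, h1, s, h2, h3, h4⟩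
      rcases us j hj with hj | rfl
      · rw [ub j hj] at h1
        rw [ui j hj] at h3
        rw [ux j hj] at h4
        exact ⟨j, hj, h1, s, h2, h3, h4⟩
      · rw [Function.update_self] at h3
        omega
    · rintro ⟨j, hj, h1, s, h2, h3, h4⟩
      exact ⟨j, by omega, by rw [ub j hj, h1], s, h2, by rwa [ui j hj], by rw [ux j hj, h4]⟩
  refine ⟨⟨h.shape, ⟨?_, ?_, ?_, ?_, ?_, ?_, ?_, ?_⟩, h.room, by rw [e]; exact h.start, ?_⟩, by rw [e]⟩
  · rw [ub 0 (by omega), h.walk.b_zero]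
  · rw [ux 0 (by omega), h.walk.x_zero]
  · intro j hj j' hj' he
    rcases us j hj with hj | rfl <;> rcases us j' hj' with hj' | rfl
    · rw [ub j hj, ub j' hj'] at he
      exact h.walk.inj j hj j' hj' he
    · rw [ub j hj, Function.update_self] at he
      exact absurd he.symm (hnew j hj)
    · rw [ub j' hj', Function.update_self] at he
      exact absurd he (hnew j' hj')
    · rfl
  · intro j hj
    rcases us j hj with hj | rfl
    · rw [ub j hj]; exact h.walk.mem j hj
    · rwa [Function.update_self]
  · intro j hj
    rcases us j hj with hj | rfl
    · rw [ui j hj]; exact h.walk.le_two j hj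
    · simp
  · intro j hj s h1 h2
    rcases us j hj with hj | rfl
    · rw [ui j hj] at h2
      rw [ub j hj, ux j hj]; exact h.walk.free j hj s h1 h2
    · rw [Function.update_self] at h2; omega
  · intro j hj
    rcases us (j + 1) hj with hj' | hj'
    · rw [ub _ hj', ub j (by omega), ux j (by omega), ui j (by omega)]
      exact h.walk.b_succ j hj'
    · obtain rfl : j = k := by omega
      rw [Function.update_self, ub j le_rfl, ux j le_rfl, ui j le_rfl, hc, hy]
  · intro j hj
    rcases us (j + 1) hj with hj' | hj'
    · rw [ux _ hj', ux j (by omega), ui j (by omega)]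
      exact h.walk.x_succ j hj'
    · obtain rfl : j = k := by omega
      rw [Function.update_self, ux j le_rfl, ui j le_rfl, hy]
  · intro j hj s h1 h2
    rcases us j hj with hj | rfl
    · rw [ui j hj] at h2
      rw [ub j hj, ux j hj, e]; exact h.corridor j hj s h1 h2
    · rw [Function.update_self] at h2; omega

/-- A single cell with two passed sides consists of one tile. -/
lemma tiles_last (h : State n v r Q 0 b x i) (hi : i 0 = 2) (hl : r + (0, -1) ∉ Q) :
    tiles Q (Passed 0 b x i) = {(r, (-1, -1))} := by
  have f1 := h.walk.free 0 le_rfl 1 le_rfl (by omega)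
  have f2 := h.walk.free 0 le_rfl 2 (by omega) (by omega)
  rw [Function.iterate_one, h.walk.b_zero, h.walk.x_zero] at f1
  rw [cw_iterate_two, h.walk.b_zero, h.walk.x_zero] at f2
  have hQ : ∀ c ∈ Q, c = r := by
    intro c hc
    rcases Relation.ReflTransGen.cases_head (h.shape.conn c hc) with h1 | ⟨w, ⟨hw, hadj⟩, -⟩
    · exact h1.symm
    · exfalso
      rcases gridGraph_adj_cases (d := (-1, 0)) (by simp [IsDir]) hadj with rfl | rfl | rfl | rfl
      · exact h.shape.left hw
      · exact f2 hw
      · exact f1 hw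
      · exact hl (by simpa [cw] using hw)
  have hp : Perp ((-1, 0) : ℤ × ℤ) (0, 1) := by simp [Perp, IsDir, cw]
  have key : ∀ n, Passed 0 b x i r n ↔ n = (0, 1) ∨ n = (1, 0) := by
    intro n
    rw [← h.walk.b_zero, h.walk.passed_iff le_rfl, hi, h.walk.x_zero]
    constructor
    · rintro ⟨s, h1, h2, rfl⟩
      interval_cases s <;> simp [cw]
    · rintro (rfl | rfl)
      · exact ⟨1, by simp [cw]⟩
      · exact ⟨2, by simp⟩
  refine tiles_ext isCorner_of_mem_tiles (by rintro t rfl; simp [IsCorner]) fun c p q hpq => ?_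
  rw [mem_tiles hpq, Set.mem_singleton_iff, Prod.mk.injEq]
  have hd : c = r → c + p + q ∉ Q := by
    rintro rfl hm
    have := hQ _ hm
    rw [add_assoc, add_eq_left] at this
    rcases hpq.isCorner.1 with h | h <;> simp [this] at h
  constructor
  · rintro ⟨h1, h2⟩
    obtain rfl := hQ c h1
    refine ⟨rfl, ?_⟩
    have h2 := h2.resolve_left (hd rfl)
    rw [key, key] at h2
    rcases hpq.cases with ⟨rfl, rfl⟩ | ⟨rfl, rfl⟩ | ⟨rfl, rfl⟩ | ⟨rfl, rfl⟩ | ⟨rfl, rfl⟩ | ⟨rfl, rfl⟩ |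
      ⟨rfl, rfl⟩ | ⟨rfl, rfl⟩ <;> simp at h2 ⊢
  · rintro ⟨rfl, h2⟩
    refine ⟨h.shape.root, Or.inr ?_⟩
    rw [key, key]
    rcases hpq.cases with ⟨rfl, rfl⟩ | ⟨rfl, rfl⟩ | ⟨rfl, rfl⟩ | ⟨rfl, rfl⟩ | ⟨rfl, rfl⟩ | ⟨rfl, rfl⟩ |
      ⟨rfl, rfl⟩ | ⟨rfl, rfl⟩ <;> simp at h2 ⊢

lemma lt_card (h : State n v r Q k b x i) : k < Q.card := by
  have : (Finset.range (k + 1)).card ≤ Q.card := by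
    refine Finset.card_le_card_of_injOn b (fun j hj => ?_) fun j hj j' hj' he => ?_
    · exact h.walk.mem j (by simpa [Nat.lt_succ_iff] using hj)
    · exact h.walk.inj j (by simpa [Nat.lt_succ_iff] using hj) j'
        (by simpa [Nat.lt_succ_iff] using hj') he
  simpa using this

lemma card_lt (h : State n v r Q k b x i) {k' : ℕ} (hk : k' < k) :
    (Q \ tail b k' k).card < Q.card := by
  refine Finset.card_lt_card ⟨Finset.sdiff_subset, fun hsub => ?_⟩
  have := hsub (h.walk.mem k le_rfl)
  exact (Finset.mem_sdiff.1 this).2 (mem_tail.2 ⟨k, hk, le_rfl, rfl⟩)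

/-- Every partially disassembled shape can be built. -/
theorem buildable (hseed : Buildable n v {(r, (-1, -1))}) :
    ∀ N M : ℕ, ∀ Q k b x i, Q.card = N → 4 * (Q.card - k) - i k = M → State n v r Q k b x i →
      (∀ j, j + 1 < k → ¬ Removable Q b x i j) →
      Buildable n v (tiles Q (Passed k b x i)) := by
  -- Removing cells lowers `N`. Otherwise `M` drops: a sweep raises `i k` by one, and a new cell
  -- gains 4 while losing at most `i k ≤ 2`. A removable cell is allowed only at the end of the
  -- walk, where it is treated at once.
  intro N
  induction N using Nat.strong_induction_on with
  | _ N ihN =>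
  intro M
  induction M using Nat.strong_induction_on with
  | _ M ihM =>
  intro Q k b x i hN hM h hnr
  have hk := h.lt_card
  have hi := h.walk.le_two k le_rfl
  have pop : ∀ k' < k, State n v r (Q \ tail b k' k) k' b x i →
      Buildable n v (tiles (Q \ tail b k' k) (Passed k' b x i)) := fun k' hk' h' =>
    ihN _ (hN ▸ h.card_lt hk') _ _ _ _ _ _ rfl rfl h' fun j hj hr => hnr j (by omega) hr.mono
  by_cases hc : b k + cw^[i k + 1] (x k) ∈ Q
  · have adv : (∀ j, j + 1 = k → ¬ Removable Q b x i j) →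
        Buildable n v (tiles Q (Passed k b x i)) := by
      intro hk'
      have hnr' : ∀ j < k, ¬ Removable Q b x i j := fun j hj => by
        rcases (show j + 1 < k ∨ j + 1 = k by omega) with h1 | h1
        exacts [hnr j h1, hk' j h1]
      have hnew : ∀ l ≤ k, b k + cw^[i k + 1] (x k) ≠ b l := fun l hl he =>
        h.walk.no_loop h.shape hl he hnr'
      obtain ⟨H, e⟩ := h.push rfl rfl hc hnew
      rw [← e]
      refine ihM _ ?_ _ _ _ _ _ hN rfl H fun j hj hr => hnr' j (by omega) ?_
      · rw [Function.update_self]; omega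
      · rcases j with _ | j
        · simpa [Removable, Function.update_of_ne (show 0 + 1 ≠ k + 1 by omega),
            Function.update_of_ne (show 0 ≠ k + 1 by omega)] using hr
        · unfold Removable at hr ⊢
          simp only [Function.update_of_ne (show j + 1 + 1 ≠ k + 1 by omega),
            Function.update_of_ne (show j + 1 ≠ k + 1 by omega)] at hr
          refine ⟨hr.1, hr.2.imp_right ?_⟩
          rintro ⟨j', h1, h2⟩
          obtain rfl : j' = j := by omega
          simp only [Function.update_of_ne (show j' ≠ k + 1 by omega)] at h2
          exact ⟨j', rfl, h2⟩
    rcases k with _ | k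
    · exact adv fun j hj => by omega
    by_cases hr : Removable Q b x i k
    · obtain ⟨hi2, ⟨hd, h0⟩ | ⟨j, rfl, h1, h0, hd, hpath⟩⟩ := hr
      · obtain ⟨H, hB⟩ := h.pop_one hi2 h0 (h.walk.shape_corner h.shape hi2 hd)
        exact hB (pop _ (by omega) H)
      · obtain ⟨H, hB⟩ := h.pop_two hi2 h1 h0 (h.walk.shape_two h.shape hi2 h1 hd hpath)
        exact hB (pop _ (by omega) H)
    · refine adv fun j hj => ?_
      obtain rfl : j = k := by omega
      exact hr
  · by_cases hi1 : i k ≤ 1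
    · obtain ⟨H, hB⟩ := h.sweep hi1 hc
      refine hB (ihM _ ?_ _ _ _ _ _ hN rfl H fun j hj hr => hnr j hj ?_)
      · rw [Function.update_self]; omega
      · unfold Removable at hr ⊢
        simp only [Function.update_of_ne (show j + 1 ≠ k by omega),
          Function.update_of_ne (show j ≠ k by omega)] at hr
        refine ⟨hr.1, hr.2.imp_right ?_⟩
        rintro ⟨j', h1, h2⟩
        rw [Function.update_of_ne (show j' ≠ k by omega)] at h2
        exact ⟨j', h1, h2⟩
    -- All sides but the entry are free: the cell is a leaf, or it is the root and the only cell
    -- left.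
    · have hi2 : i k = 2 := by omega
      rw [hi2, cw_iterate_three] at hc
      rcases k with _ | k
      · rw [h.walk.b_zero, h.walk.x_zero] at hc
        rw [h.tiles_last hi2 (by simpa [cw] using hc)]
        exact hseed
      have hsh := h.walk.shape_leaf h.shape hi2 hc
      by_cases h0 : i k = 0
      · obtain ⟨f1, -⟩ := h.corner_facts hi2
        have hb := h.walk.b_add_x (Nat.lt_succ_self k)
        have hk0 : k ≠ 0 := by
          rintro rfl
          have := h.walk.one_le_i_zero h.shape (by omega)
          omega
        obtain ⟨j, hj, -, hbj, hij, hxj⟩ := h.walk.concave h.shape le_rfl f1 (by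
          rw [add_right_comm, hb, h.walk.cw_x_succ (Nat.lt_succ_self k), h0]
          exact h.walk.b_add_x_mem (by omega) hk0)
        obtain rfl : k = j + 1 := by omega
        obtain ⟨H, hB⟩ := h.pop_leaf hi2 hc hij hbj hxj hsh
        exact hB (pop _ (by omega) H)
      · obtain ⟨H, hB⟩ := h.pop_one hi2 h0 hsh
        exact hB (pop _ (by omega) H)

end State

/-! ### Placement in the workspace -/

lemma walk_bound {s : Set (ℤ × ℤ)} {u w : s} (p : (gridGraph.induce s).Walk u w) :
    |(w : ℤ × ℤ).1 - (u : ℤ × ℤ).1| ≤ p.length ∧ |(w : ℤ × ℤ).2 - (u : ℤ × ℤ).2| ≤ p.length := by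
  induction p with
  | nil => simp
  | cons h p ih =>
    simp only [SimpleGraph.comap_adj, gridGraph, Function.Embedding.subtype_apply] at h
    simp only [SimpleGraph.Walk.length_cons]
    push_cast
    grind

/-- A polyomino with `N` tiles has width and height at most `N`. -/
lemma IsPolyomino.abs_sub_lt {P : Finset (ℤ × ℤ)} (hP : IsPolyomino P) {r c : ℤ × ℤ}
    (hr : r ∈ P) (hc : c ∈ P) : |c.1 - r.1| < P.card ∧ |c.2 - r.2| < P.card := by
  obtain ⟨p, hp⟩ := hP.preconnected.exists_isPath ⟨r, hr⟩ ⟨c, hc⟩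
  have h1 := hp.length_lt
  have h2 := walk_bound p
  simp only [Finset.coe_sort_coe, Fintype.card_coe] at h1
  have h3 : (p.length : ℤ) < P.card := by exact_mod_cast h1
  exact ⟨h2.1.trans_lt h3, h2.2.trans_lt h3⟩

lemma IsPolyomino.reflTransGen {P : Finset (ℤ × ℤ)} (hP : IsPolyomino P) {r c : ℤ × ℤ}
    (hr : r ∈ P) (hc : c ∈ P) :
    Relation.ReflTransGen (fun a b => b ∈ P ∧ gridGraph.Adj a b) r c := by
  have h := (SimpleGraph.reachable_iff_reflTransGen _ _).1
    (hP.preconnected ⟨r, hr⟩ ⟨c, hc⟩)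
  exact h.lift (Subtype.val) fun a b hab => ⟨b.2, hab⟩

/-- The leftmost tile of the top row is a root of a non-degenerate polyomino. -/
lemma IsPolyomino.exists_shape {P : Finset (ℤ × ℤ)} (hP : IsPolyomino P)
    (hnd : NonDegenerate P) : ∃ r, Shape r P := by
  obtain ⟨⟨a, ha⟩⟩ := hP.nonempty
  obtain ⟨m, hm, hmax⟩ := P.exists_max_image (fun c => c.2) ⟨a, ha⟩
  obtain ⟨r, hr, hmin⟩ := (P.filter fun c => c.2 = m.2).exists_min_image (fun c => c.1)
    ⟨m, by simp [hm]⟩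
  rw [Finset.mem_filter] at hr
  refine ⟨r, hr.1, fun c hc => hP.reflTransGen hr.1 hc, hnd, fun c hc => hr.2 ▸ hmax c hc,
    fun h => ?_⟩
  have := hmin (r + (-1, 0)) (by simp [h, hr.2])
  simp at this

lemma mem_scaledCopy_two {P : Finset (ℤ × ℤ)} {z : ℤ × ℤ} :
    z ∈ scaledCopy 2 P ↔ (z.1 / 2, z.2 / 2) ∈ P := by
  simp only [scaledCopy, Finset.mem_biUnion, Finset.mem_product, Finset.mem_Ico, Nat.cast_ofNat]
  constructor
  · rintro ⟨⟨a, b⟩, hp, h⟩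
    convert hp <;> dsimp only at h <;> omega
  · exact fun h => ⟨_, h, by dsimp only; omega⟩

lemma card_scaledCopy_two (P : Finset (ℤ × ℤ)) : (scaledCopy 2 P).card = 4 * P.card := by
  rw [scaledCopy, Finset.card_biUnion]
  · simp [mul_comm]
  · rintro ⟨a, b⟩ - ⟨c, d⟩ - h
    rw [Function.onFun, Finset.disjoint_left]
    rintro ⟨x, y⟩ h1 h2
    simp only [Finset.mem_product, Finset.mem_Ico, Nat.cast_ofNat] at h1 h2
    exact h (by ext <;> dsimp only <;> omega)

/-- The translated copy consists of the four corners of every cell. -/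
lemma coe_translateBy_scaledCopy (v : ℤ × ℤ) (P : Finset (ℤ × ℤ)) :
    (translateBy v (scaledCopy 2 P) : Set (ℤ × ℤ)) = pt v '' {t | t.1 ∈ P ∧ IsCorner t.2} := by
  ext ⟨x, y⟩
  simp only [translateBy, Finset.coe_map, Set.mem_image, Finset.mem_coe, mem_scaledCopy_two,
    Set.mem_ofPred_eq, addRightEmbedding_apply]
  constructor
  · rintro ⟨⟨a, b⟩, h, he⟩
    refine ⟨((a / 2, b / 2), (2 * (a % 2) - 1, 2 * (b % 2) - 1)), ⟨h, ?_⟩, ?_⟩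
    · simp only [IsCorner]; omega
    · rw [← he]; ext <;> simp only [pt, Prod.fst_add, Prod.snd_add] <;> omega
  · rintro ⟨⟨⟨a, b⟩, c, d⟩, ⟨h, hu⟩, he⟩
    refine ⟨(x - v.1, y - v.2), ?_, by ext <;> simp⟩
    simp only [pt, Prod.mk.injEq, IsCorner] at he hu
    convert h <;> dsimp only <;> omega

section

variable {n : ℕ} {v r : ℤ × ℤ} {P : Finset (ℤ × ℤ)}

/-- A tile can go up along the left border, then to the right above the root. -/
lemma hover_start {S : Set ((ℤ × ℤ) × (ℤ × ℤ))} (hn : 4 ≤ n)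
    (hv : v = ((n : ℤ) - 2 * r.1, (n : ℤ) - 2 * r.2))
    (hS : ∀ t ∈ S, 2 ≤ (pt v t).1 ∧ (pt v t).2 ≤ n + 1) :
    Hover n v S (r + (0, 1), (0, 1) + (-1, 0)) := by
  -- Tiles occupy columns from 2 on and rows up to `n + 1`, so column 0 and row `n + 3` are clear.
  have hpt : pt v (r + (0, 1), (0, 1) + (-1, 0)) = ((n : ℤ), (n : ℤ) + 3) := by
    subst hv; ext <;> simp [pt]; omega
  have far : ∀ z : ℤ × ℤ, z.1 ≤ 1 ∨ (n : ℤ) + 2 ≤ z.2 → z ∉ pt v '' S := by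
    rintro _ hz ⟨t, ht, rfl⟩
    have := hS t ht
    omega
  have clear : ∀ z : ℤ × ℤ, z.1 = 0 ∨ z.2 = (n : ℤ) + 3 → ClearAt v S z := by
    refine fun z hz => ⟨far z (by omega), fun w hw => far w ?_⟩
    obtain ⟨a, b⟩ := z
    obtain ⟨c, d⟩ := w
    simp only [gridGraph] at hw hz ⊢
    clear far hS hpt
    have h1 := abs_le.1 (show |a - c| ≤ 1 by have := abs_nonneg (b - d); omega)
    have h2 := abs_le.1 (show |b - d| ≤ 1 by have := abs_nonneg (a - c); omega)
    omega
  have up : ∀ m : ℕ, m ≤ n + 3 → Relation.ReflTransGen (fun a b => a ∈ workspace n ∧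
      b ∈ workspace n ∧ gridGraph.Adj a b ∧ ClearAt v S a) (0, 0) (0, (m : ℤ)) := by
    intro m
    induction m with
    | zero => exact fun _ => .refl
    | succ m ih =>
      refine fun hm => (ih (by omega)).tail ⟨?_, ?_, ?_, clear _ (Or.inl rfl)⟩ <;>
        simp [workspace, gridGraph] <;> omega
  have right : ∀ m : ℕ, m ≤ n → Relation.ReflTransGen (fun a b => a ∈ workspace n ∧
      b ∈ workspace n ∧ gridGraph.Adj a b ∧ ClearAt v S a) (0, 0) ((m : ℤ), (n : ℤ) + 3) := by
    intro m
    induction m with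
    | zero => exact fun _ => by simpa using up (n + 3) le_rfl
    | succ m ih =>
      refine fun hm => (ih (by omega)).tail ⟨?_, ?_, ?_, clear _ (Or.inr rfl)⟩ <;>
        simp [workspace, gridGraph] <;> omega
  rw [Hover, hpt]
  exact ⟨right n le_rfl, by simp [workspace]; omega, clear _ (Or.inr rfl)⟩

/-- The disassembly starts with the walk resting at the root and no side passed. The vector `v` puts
the lower left tile of the root, the last one remaining, on the seed. -/
lemma Shape.buildable (h : Shape r P) (hn : n = 4 * P.card)
    (hv : v = ((n : ℤ) - 2 * r.1, (n : ℤ) - 2 * r.2))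
    (hb : ∀ c ∈ P, |c.1 - r.1| < P.card ∧ |c.2 - r.2| < P.card) :
    Buildable n v {t | t.1 ∈ P ∧ IsCorner t.2} := by
  have hpos : 0 < P.card := Finset.card_pos.2 ⟨r, h.root⟩
  have hn' : (n : ℤ) = 4 * P.card := by exact_mod_cast hn
  have hp : ∀ c d, ¬ Passed 0 (fun _ => r) (fun _ => (-1, 0)) (fun _ => 0) c d := by
    rintro c d ⟨j, -, -, s, h1, h2, -⟩
    exact absurd (h1.trans h2) (by simp)
  have ht : tiles P (Passed 0 (fun _ => r) (fun _ => (-1, 0)) (fun _ => 0)) =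
      {t | t.1 ∈ P ∧ IsCorner t.2} := by
    ext t
    simp [tiles, hp]
  rw [← ht]
  refine State.buildable (r := r) ?_ _ _ P 0 _ _ _ rfl rfl ⟨h, ?_, ?_, ?_, ?_⟩ (by simp)
  · refine ⟨{((n : ℤ), (n : ℤ))}, ?_, .refl⟩
    subst hv
    simp [pt]
  · exact ⟨rfl, rfl, by omega, fun _ _ => h.root, by simp, by intros; omega, by simp, by simp⟩
  · rintro c hc d h1 h2 u hu
    have := hb c hc
    rw [abs_lt, abs_lt] at this
    rw [abs_le] at h1 h2
    subst hv
    simp only [workspace, pt, Finset.mem_product, Finset.mem_Ico, Prod.fst_add, Prod.snd_add]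
    obtain ⟨h3 | h3, h4 | h4⟩ := hu <;> rw [h3, h4] <;> norm_num <;> omega
  · refine hover_start (by omega) hv ?_
    rw [ht]
    rintro ⟨c, u⟩ ⟨hc, hu⟩
    have := hb c hc
    rw [abs_lt, abs_lt] at this
    have := h.top c hc
    subst hv
    dsimp only at hu
    simp only [pt]
    obtain ⟨h3 | h3, h4 | h4⟩ := hu <;> rw [h3, h4] <;> norm_num <;> omega
  · intros; omega

end

end TiltAssembly

theorem mainTheorem2 (P : Finset (ℤ × ℤ)) (hP : TiltAssembly.IsPolyomino P)
    (hnd : TiltAssembly.NonDegenerate P) :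
    TiltAssembly.Constructible (TiltAssembly.scaledCopy 2 P) := by
  obtain ⟨r, hr⟩ := hP.exists_shape hnd
  obtain ⟨F, hF, hF'⟩ := hr.buildable (TiltAssembly.card_scaledCopy_two P) rfl
    fun c hc => hP.abs_sub_lt hr.root hc
  rw [← TiltAssembly.coe_translateBy_scaledCopy, Finset.coe_inj] at hF
  exact ⟨_, hF ▸ hF'⟩
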